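/- Let $X$ be a Noetherian scheme. Let $D^b_{\mathrm{coh}}(X)$ be the full subcategory of the derived category $D(\mathcal{O}_X)$ of complexes of sheaves of $\mathcal{O}_X$-modules consisting of the objects with bounded and coherent cohomology; it is a triangulated subcategory, and it contains the object $i_*\mathcal{O}_Z$ (in degree $0$; equivalently $\mathbb{R}i_*\mathcal{O}_Z$) for every closed immersion $i\colon Z\to X$ with $Z$ an integral scheme. For $E\in D^b_{\mathrm{coh}}(X)$ put $\operatorname{supp}E=\{p\in X : \mathcal{H}^n(E)_p\neq 0 \text{ for some } n\in\mathbb{Z}\}$. For a collection $\mathcal{S}$ of objects of $D^b_{\mathrm{coh}}(X)$ let $\langle\mathcal{S}\rangle$ be the smallest thick subcategory (full triangulated subcategory closed under retracts) of $D^b_{\mathrm{coh}}(X)$ containing $\mathcal{S}$. 1. Let $l\geq 0$ be an integer, and let $\mathcal{Z}_l$ be the collection of the objects $i_*\mathcal{O}_Z$ for all closed immersions $i\colon Z\to X$ with $Z$ an integral scheme of Krull dimension $\dim Z\leq l$. Then every $E\in D^b_{\mathrm{coh}}(X)$ with $\dim\operatorname{supp}E\leq l$ belongs to $\langle\mathcal{Z}_l\rangle$.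 2. If $X$ has finite Krull dimension and $\mathcal{Z}$ is the collection of the objects $i_*\mathcal{O}_Z$ for all closed immersions $i\colon Z\to X$ with $Z$ an integral scheme, then $D^b_{\mathrm{coh}}(X)=\langle\mathcal{Z}\rangle$. -/

import Mathlib

open CategoryTheory AlgebraicGeometry

universe w u

/-- The thick subcategory generated by `P` in a (pre)triangulated category: an object lies in it
if and only if it lies in every thick subcategory (full triangulated subcategory closed under
retracts, hence under isomorphisms) which contains `P`. It always contains the zero objects. -/
def CategoryTheory.ObjectProperty.thickClosure {C : Type*} [Category* C] [Limits.HasZeroObject C]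
    [HasShift C ℤ] [Preadditive C] [∀ n : ℤ, (shiftFunctor C n).Additive] [Pretriangulated C]
    (P : ObjectProperty C) : ObjectProperty C :=
  fun E => ∀ Q : ObjectProperty C, Q.IsTriangulated → Q.IsStableUnderRetracts → P ≤ Q → Q E

namespace AlgebraicGeometry.Scheme

/-- A sheaf of modules on a (locally) Noetherian scheme is coherent if it is quasi-coherent and of
finite type. -/
def IsCoherentModule {X : Scheme.{u}} (M : X.Modules) : Prop :=
  SheafOfModules.IsQuasicoherent (R := X.ringCatSheaf) M ∧
    SheafOfModules.IsFiniteType (R := X.ringCatSheaf) M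

section

variable (X : Scheme.{u}) [HasDerivedCategory.{w} X.Modules]

/-- The objects of `D(𝒪_X)`, the derived category of all complexes of sheaves of `𝒪_X`-modules,
which have bounded and coherent cohomology. -/
def isBoundedCoherent : ObjectProperty (DerivedCategory X.Modules) :=
  fun E => (∃ a b : ℤ, ∀ n : ℤ, (n < a ∨ b < n) →
      Limits.IsZero ((DerivedCategory.homologyFunctor X.Modules n).obj E)) ∧
    ∀ n : ℤ, IsCoherentModule ((DerivedCategory.homologyFunctor X.Modules n).obj E)

/-- The category `D^b_coh(X)`, a full subcategory of `D(𝒪_X)`. -/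
abbrev DbCoh : Type _ := (isBoundedCoherent X).FullSubcategory

variable {X}

/-- The support of an object of `D(𝒪_X)`: the points at which the stalk of some cohomology sheaf
is nonzero. -/
def derivedSupport (E : DerivedCategory X.Modules) : Set X :=
  {x | ∃ n : ℤ, ¬ Limits.IsZero ((TopCat.Presheaf.stalkFunctor Ab x).obj
    (Modules.presheaf ((DerivedCategory.homologyFunctor X.Modules n).obj E)))}

/-- The object `i_* 𝒪_Z` of `D(𝒪_X)`, placed in degree `0`. For a closed immersion `i` the functor
`i_*` is exact, so that this is also `ℝi_* 𝒪_Z`. -/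
noncomputable def pushforwardStructureSheaf {Z : Scheme.{u}} (i : Z ⟶ X) :
    DerivedCategory X.Modules :=
  (DerivedCategory.singleFunctor X.Modules 0).obj
    ((Modules.pushforward i).obj (SheafOfModules.unit Z.ringCatSheaf))

variable (X)

/-- The objects of `D(𝒪_X)` isomorphic to `i_* 𝒪_Z` for a closed immersion `i : Z ⟶ X` with `Z` an
integral scheme. -/
def integralStructureSheaves : ObjectProperty (DerivedCategory X.Modules) :=
  fun E => ∃ (Z : Scheme.{u}) (i : Z ⟶ X), IsClosedImmersion i ∧ IsIntegral Z ∧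
    Nonempty (E ≅ pushforwardStructureSheaf i)

/-- The objects of `D(𝒪_X)` isomorphic to `i_* 𝒪_Z` for a closed immersion `i : Z ⟶ X` with `Z` an
integral scheme of Krull dimension at most `l`. -/
def integralStructureSheavesOfDimLE (l : ℕ) : ObjectProperty (DerivedCategory X.Modules) :=
  fun E => ∃ (Z : Scheme.{u}) (i : Z ⟶ X), IsClosedImmersion i ∧ IsIntegral Z ∧
    topologicalKrullDim Z ≤ l ∧ Nonempty (E ≅ pushforwardStructureSheaf i)

end

end AlgebraicGeometry.Scheme

/-! Both claims follow from one statement (`prop_of_forall_pushforwardStructureSheaf`): a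
triangulated subcategory closed under isomorphisms contains `E` as soon as it contains `i_* 𝒪_Z` for
every integral closed `Z ⊆ supp E`. Such a `Z` has dimension at most that of `supp E`.

Truncation triangles build `E` from shifts of its finitely many nonzero cohomology sheaves
(`prop_of_prop_single_homology`), so a coherent sheaf `F` in degree `0` may be considered; short
exact sequences become distinguished triangles. Dévissage runs by induction on an open set `O` on
which `F` vanishes. A nonzero `F` has an associated point `x`, the annihilator of a section `s` over
an affine open `U` being the prime of `x`. With `Z` the closure of `x` and `j` the inclusion of `U`,
the map `𝒪_X → j_*(F|_U)` given by `s` has the same kernel as `𝒪_X → i_* 𝒪_Z`, so `i_* 𝒪_Z` embeds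
into `j_*(F|_U)`. The preimage `G` of `i_* 𝒪_Z` in `F` is a nonzero coherent submodule, and the
kernel and cokernel of `G → i_* 𝒪_Z` vanish on `O ∪ U`, which is strictly larger than `O`
(`exists_mono_of_not_isZero`). By induction `G` lies in the subcategory, and the Noetherian property
passes from such submodules to `F` (`DevissageProperty.of_forall_exists_mono`).

The closure properties of coherent modules used here are proved with sections over affine opens
(`isCoherentModule_iff`). -/

/-- An epimorphism of sheaves of modules is locally surjective. -/
lemma SheafOfModules.isLocallySurjective_of_epi {C : Type*} [Category* C]
    {J : GrothendieckTopology C} {R : Sheaf J RingCat.{u}} [HasSheafify J AddCommGrpCat.{u}]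
    [J.WEqualsLocallyBijective AddCommGrpCat.{u}] {M N : SheafOfModules.{u} R} (φ : M ⟶ N)
    [h : Epi φ] : PresheafOfModules.IsLocallySurjective J φ.val := by
  let L := PresheafOfModules.sheafification.{u} (𝟙 R.obj)
  let adj := PresheafOfModules.sheafificationAdjunction.{u} (𝟙 R.obj)
  have : IsIso adj.counit := inferInstanceAs
    (IsIso (PresheafOfModules.sheafificationAdjunction.{u} (𝟙 R.obj)).counit)
  have hc (P) : IsIso (adj.counit.app P) := NatIso.isIso_app_of_isIso _ _
  let f : (SheafOfModules.forget R).obj M ⟶ (SheafOfModules.forget R).obj N :=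
    (SheafOfModules.forget R).map φ
  have hf : Epi (L.map f) :=
    ((MorphismProperty.epimorphisms _).arrow_mk_iso_iff
      (Arrow.isoMk (@asIso _ _ _ _ _ (hc M)) (@asIso _ _ _ _ _ (hc N))
        (adj.counit.naturality φ).symm : Arrow.mk (L.map f) ≅ Arrow.mk φ)).mpr h
  -- Sheafification preserves monomorphisms, so the inclusion of the presheaf image becomes both
  -- mono and epi; before sheafification it is therefore locally bijective.
  have : IsIso (L.map (Limits.image.ι f)) := by
    have : Epi (L.map (Limits.factorThruImage f) ≫ L.map (Limits.image.ι f)) := by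
      rwa [← L.map_comp, Limits.image.fac]
    have := epi_of_epi (L.map (Limits.factorThruImage f)) (L.map (Limits.image.ι f))
    exact isIso_of_mono_of_epi _
  have h₁ : PresheafOfModules.IsLocallySurjective J (Limits.image.ι f) := by
    have h := PresheafOfModules.inverseImage_W_toPresheaf_eq_inverseImage_isomorphisms.{u}
      (𝟙 R.obj)
    exact (h.ge _ this : J.W _).isLocallySurjective
  have h₂ : PresheafOfModules.IsLocallySurjective J (Limits.factorThruImage f) :=
    Presheaf.isLocallySurjective_of_surjective _ _
      fun V ↦ PresheafOfModules.surjective_of_epi (Limits.factorThruImage f) V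
  change Presheaf.IsLocallySurjective J ((PresheafOfModules.toPresheaf _).map f)
  rw [← Limits.image.fac f, Functor.map_comp]
  infer_instance

/-! ### Sections over open sets: restriction, gluing, exactness, local lifting. -/

namespace AlgebraicGeometry.Scheme

variable {X : Scheme.{u}}

/-- Restriction of functions to a smaller open subset, as a ring homomorphism. -/
noncomputable def resHom {U V : X.Opens} (h : V ≤ U) : Γ(X, U) →+* Γ(X, V) :=
  (X.presheaf.map (homOfLE h).op).hom

lemma resHom_resHom {U V W : X.Opens} (h : V ≤ U) (h' : W ≤ V) (a : Γ(X, U)) :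
    resHom h' (resHom h a) = resHom (h'.trans h) a := by
  simp only [resHom, ← CommRingCat.comp_apply, ← Functor.map_comp]
  rfl

@[simp]
lemma resHom_self {U : X.Opens} (a : Γ(X, U)) : resHom (le_refl U) a = a := by
  simp [resHom]

namespace Modules

variable {M N K : X.Modules} {U V W : X.Opens}

/-- Restriction of sections of a sheaf of modules to a smaller open subset. -/
noncomputable def res (M : X.Modules) {U V : X.Opens} (h : V ≤ U) : Γ(M, U) →+ Γ(M, V) :=
  (M.presheaf.map (homOfLE h).op).hom

lemma res_res (h : V ≤ U) (h' : W ≤ V) (s : Γ(M, U)) :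
    M.res h' (M.res h s) = M.res (h'.trans h) s := by
  simp only [res, ← AddCommGrpCat.comp_apply, ← Functor.map_comp]
  rfl

@[simp]
lemma res_self (s : Γ(M, U)) : M.res (le_refl U) s = s := by
  simp [res]

lemma res_smul (h : V ≤ U) (a : Γ(X, U)) (s : Γ(M, U)) :
    M.res h (a • s) = resHom h a • M.res h s :=
  map_smul M _ _ _

lemma app_res (φ : M ⟶ N) (h : V ≤ U) (s : Γ(M, U)) :
    φ.app V (M.res h s) = N.res h (φ.app U s) :=
  congr($(φ.mapPresheaf.naturality (homOfLE h).op) s)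

lemma app_smul (φ : M ⟶ N) (a : Γ(X, U)) (s : Γ(M, U)) :
    φ.app U (a • s) = a • φ.app U s := φ.app_smul a s

lemma res_ext {ι : Type*} (V : ι → X.Opens) (hV : ∀ i, V i ≤ U) (hU : U ≤ ⨆ i, V i)
    {s t : Γ(M, U)} (h : ∀ i, M.res (hV i) s = M.res (hV i) t) : s = t :=
  TopCat.Sheaf.eq_of_locally_eq' ⟨_, M.isSheaf⟩ V U (fun i ↦ homOfLE (hV i)) hU s t h

lemma exists_glue {ι : Type*} (V : ι → X.Opens) (hV : ∀ i, V i ≤ U) (hU : U ≤ ⨆ i, V i)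
    (s : ∀ i, Γ(M, V i))
    (h : ∀ i j, M.res (inf_le_left : V i ⊓ V j ≤ V i) (s i) =
      M.res (inf_le_right : V i ⊓ V j ≤ V j) (s j)) :
    ∃ t : Γ(M, U), ∀ i, M.res (hV i) t = s i :=
  (TopCat.Sheaf.existsUnique_gluing' ⟨_, M.isSheaf⟩ V U (fun i ↦ homOfLE (hV i)) hU s h).exists

lemma res_ext_of_mem {s t : Γ(M, U)}
    (h : ∀ x ∈ U, ∃ (V : X.Opens) (hV : V ≤ U), x ∈ V ∧ M.res hV s = M.res hV t) : s = t := by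
  choose V hV hx hst using h
  exact res_ext (fun x : U ↦ V x.1 x.2) (fun x ↦ hV x.1 x.2)
    (fun x hxU ↦ TopologicalSpace.Opens.mem_iSup.mpr ⟨⟨x, hxU⟩, hx x hxU⟩) fun x ↦ hst x.1 x.2

/-- Taking sections over an open subset, as a functor to abelian groups. -/
noncomputable def sectionsFunctor (U : X.Opens) : X.Modules ⥤ Ab.{u} :=
  toPresheaf X ⋙ (CategoryTheory.evaluation _ _).obj (.op U)

instance (U : X.Opens) : Limits.PreservesFiniteLimits (sectionsFunctor U) :=
  have : Limits.PreservesFiniteLimits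
      ((CategoryTheory.evaluation (TopologicalSpace.Opens X)ᵒᵖ Ab.{u}).obj (.op U)) :=
    ⟨fun _ _ _ ↦ inferInstance⟩
  Limits.comp_preservesFiniteLimits _ _

instance (U : X.Opens) : (sectionsFunctor U).Additive where
  map_add := rfl

lemma app_injective (φ : M ⟶ N) [Mono φ] (U : X.Opens) : Function.Injective (φ.app U) := by
  have : Mono ((sectionsFunctor U).map φ) := inferInstance
  exact (AddCommGrpCat.mono_iff_injective ((sectionsFunctor U).map φ)).mp this

lemma exists_app_eq_of_exact {S : ShortComplex X.Modules} (hS : S.Exact) [Mono S.f]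
    {U : X.Opens} (x : Γ(S.X₂, U)) (hx : S.g.app U x = 0) : ∃ y, S.f.app U y = x := by
  have := hS.map_of_mono_of_preservesKernel (sectionsFunctor U) inferInstance inferInstance
  rw [ShortComplex.ab_exact_iff] at this
  exact this x hx

lemma app_comp_apply (φ : M ⟶ N) (ψ : N ⟶ K) (x : Γ(M, U)) :
    (φ ≫ ψ).app U x = ψ.app U (φ.app U x) := rfl

lemma app_f_g (S : ShortComplex X.Modules) {U : X.Opens} (x : Γ(S.X₁, U)) :
    S.g.app U (S.f.app U x) = 0 := by
  rw [← app_comp_apply, S.zero]; rfl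

lemma isLocallySurjective_of_epi (φ : M ⟶ N) [h : Epi φ] :
    Presheaf.IsLocallySurjective (Opens.grothendieckTopology X) φ.mapPresheaf :=
  SheafOfModules.isLocallySurjective_of_epi (R := X.ringCatSheaf) φ (h := h)

/-- An epimorphism of sheaves of modules is locally surjective on sections. -/
lemma exists_local_preimage (φ : M ⟶ N) [Epi φ] (s : Γ(N, U)) {x : X} (hx : x ∈ U) :
    ∃ (V : X.Opens) (hV : V ≤ U) (t : Γ(M, V)), x ∈ V ∧ φ.app V t = N.res hV s := by
  obtain ⟨V, i, ⟨t, ht⟩, hxV⟩ :=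
    (isLocallySurjective_of_epi φ).imageSieve_mem s x hx
  exact ⟨V, leOfHom i, t, hxV, ht⟩

end Modules

end AlgebraicGeometry.Scheme

/-! ### Coherence in terms of sections over affine opens. -/

namespace AlgebraicGeometry.Scheme.Modules

variable {X : Scheme.{u}} {M N K : X.Modules} {U V W : X.Opens}

/-- Sections over affine opens which vanish on a basic open `D(f)` are killed by a power of `f`. -/
def IsPowerTorsion (M : X.Modules) : Prop :=
  ∀ (U : X.Opens), IsAffineOpen U → ∀ (f : Γ(X, U)) (t : Γ(M, U)),
    M.res (X.basicOpen_le f) t = 0 → ∃ n : ℕ, f ^ n • t = 0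

/-- Sections over a basic open `D(f)` of an affine open extend after multiplication by a power
of `f`. -/
def IsPowerExtendable (M : X.Modules) : Prop :=
  ∀ (U : X.Opens), IsAffineOpen U → ∀ (f : Γ(X, U)) (s : Γ(M, X.basicOpen f)),
    ∃ (n : ℕ) (t : Γ(M, U)), M.res (X.basicOpen_le f) t = resHom (X.basicOpen_le f) f ^ n • s

/-- The description of coherent modules in terms of sections over affine opens. -/
structure IsSectionwiseCoherent (M : X.Modules) : Prop where
  torsion : M.IsPowerTorsion
  extendable : M.IsPowerExtendable
  finite (U : X.Opens) (hU : IsAffineOpen U) : Module.Finite Γ(X, U) Γ(M, U)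

/-- Compares the two ways in which `Γ(X, U)` acts on sections over an open subset of `Spec Γ(X, U)`:
as the base ring of the spectrum, and by restriction of functions on `X`. -/
lemma fromSpec_ring_eq (hU : IsAffineOpen U) (V : (Spec Γ(X, U)).Opens)
    (h : hU.fromSpec ''ᵁ V ≤ U) :
    (Scheme.ΓSpecIso Γ(X, U)).inv ≫ (Spec Γ(X, U)).presheaf.map V.leTop.op ≫
      (hU.fromSpec.appIso V).inv = X.presheaf.map (homOfLE h).op := by
  rw [← Category.assoc, Iso.comp_inv_eq, Scheme.Hom.appIso_hom]
  rw [hU.fromSpec.naturality_assoc, hU.fromSpec_app_self]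
  simp only [Category.assoc, ← Functor.map_comp]
  rfl

lemma fromSpec_image_le (hU : IsAffineOpen U) (V : (Spec Γ(X, U)).Opens) :
    hU.fromSpec ''ᵁ V ≤ U := by
  conv_rhs => rw [← hU.opensRange_fromSpec]
  exact hU.fromSpec.image_le_opensRange V

lemma smul_restrict_fromSpec (M : X.Modules) (hU : IsAffineOpen U) (V : (Spec Γ(X, U)).Opens)
    (r : Γ(X, U)) (x : Γ(M.restrict hU.fromSpec, V)) :
    (M.restrictAppIso hU.fromSpec V).hom (r • x) =
      resHom (fromSpec_image_le hU V) r • (M.restrictAppIso hU.fromSpec V).hom x := by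
  rw [smul_Spec_def, smul_restrictAppIso_hom_apply]
  congr 1
  exact congr($(fromSpec_ring_eq hU V (fromSpec_image_le hU V)) r)

/-- Since `tilde` is full and faithful, the epimorphism from a finite free sheaf comes from a linear
map out of a finite free module, and that map is again an epimorphism. -/
lemma finite_of_generatingSections {R : CommRingCat.{u}} (M : (Spec R).Modules)
    [M.IsQuasicoherent] (σ : M.GeneratingSections) [σ.IsFiniteType] :
    Module.Finite R Γ(M, ⊤) := by
  have he : IsIso M.fromTildeΓ := inferInstance
  let e : tilde ((modulesSpecToSheaf.obj M).presheaf.obj (.op ⊤)) ≅ M := @asIso _ _ _ _ _ he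
  let F : (Spec R).Modules := SheafOfModules.free σ.I
  let π : F ⟶ M := σ.π
  have hπ : Epi π := σ.epi
  let t : tilde (ModuleCat.of R (σ.I →₀ R)) ≅ F := tildeFinsupp σ.I
  obtain ⟨g, hg⟩ := (tilde.functor R).map_surjective (t.hom ≫ π ≫ e.inv)
  have : Epi ((tilde.functor R).map g) := by
    rw [hg]
    have h₁ : Epi e.inv := IsIso.epi_of_iso _
    have h₂ : Epi t.hom := IsIso.epi_of_iso _
    have h₃ := epi_comp π e.inv
    exact epi_comp t.hom (π ≫ e.inv)
  have : Epi g := (tilde.functor R).epi_of_epi_map this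
  have hg : Function.Surjective g := (ModuleCat.epi_iff_surjective g).mp this
  have : Finite σ.I := SheafOfModules.GeneratingSections.IsFiniteType.finite
  exact Module.Finite.of_surjective g.hom hg

/-- Sections of the pullback of `M` along `Spec Γ(X, U) ⟶ X`, as sections of `M`. -/
noncomputable def ofFromSpec (M : X.Modules) (hU : IsAffineOpen U) {V : (Spec Γ(X, U)).Opens}
    (h : W ≤ hU.fromSpec ''ᵁ V) : Γ(M.restrict hU.fromSpec, V) →+ Γ(M, W) :=
  (M.res h).comp (M.restrictAppIso hU.fromSpec V).hom.hom

lemma ofFromSpec_smul (M : X.Modules) (hU : IsAffineOpen U) {V : (Spec Γ(X, U)).Opens}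
    (h : W ≤ hU.fromSpec ''ᵁ V) (r : Γ(X, U)) (x : Γ(M.restrict hU.fromSpec, V)) :
    M.ofFromSpec hU h (r • x) =
      resHom (h.trans (fromSpec_image_le hU V)) r • M.ofFromSpec hU h x := by
  refine (congrArg (M.res h) (smul_restrict_fromSpec M hU V r x)).trans ?_
  rw [res_smul, resHom_resHom]
  rfl

lemma ofFromSpec_bijective (M : X.Modules) (hU : IsAffineOpen U) {V : (Spec Γ(X, U)).Opens}
    (h : W = hU.fromSpec ''ᵁ V) : Function.Bijective (M.ofFromSpec hU h.le) := by
  subst h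
  have : ∀ x, M.ofFromSpec hU le_rfl x = (M.restrictAppIso hU.fromSpec V).hom x :=
    fun x ↦ res_self _
  exact ⟨fun x y h ↦ by rwa [this, this] at h, fun x ↦ ⟨(M.restrictAppIso hU.fromSpec V).inv x, this _⟩⟩

lemma ofFromSpec_res (M : X.Modules) (hU : IsAffineOpen U) {V V' : (Spec Γ(X, U)).Opens}
    {W W' : X.Opens} (h : W ≤ hU.fromSpec ''ᵁ V) (h' : W' ≤ hU.fromSpec ''ᵁ V')
    (hV : V' ≤ V) (hW : W' ≤ W) (x : Γ(M.restrict hU.fromSpec, V)) :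
    M.ofFromSpec hU h' ((M.restrict hU.fromSpec).res hV x) = M.res hW (M.ofFromSpec hU h x) := by
  dsimp only [ofFromSpec, AddMonoidHom.comp_apply]
  rw [res_res]
  exact res_res (M := M) (hU.fromSpec.image_mono hV) h' x

lemma exists_pow_smul_eq_zero_spec {R : CommRingCat.{u}} (M : (Spec R).Modules)
    [M.IsQuasicoherent] (f : R) {V : (Spec R).Opens} (hV : V = PrimeSpectrum.basicOpen f)
    (x : Γ(M, ⊤)) (hx : M.res (le_top : V ≤ ⊤) x = 0) : ∃ n : ℕ, f ^ n • x = 0 := by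
  subst hV
  let φ := ((modulesSpecToSheaf.obj M).obj.map (PrimeSpectrum.basicOpen f).leTop.op).hom
  have hl : IsLocalizedModule (.powers f) φ :=
    (isIso_fromTildeΓ_iff_isLocalizing M).mp inferInstance f
  obtain ⟨⟨_, n, rfl⟩, hn⟩ := (IsLocalizedModule.eq_zero_iff (.powers f) φ).mp hx
  exact ⟨n, hn⟩

lemma exists_res_eq_pow_smul_spec {R : CommRingCat.{u}} (M : (Spec R).Modules)
    [M.IsQuasicoherent] (f : R) {V : (Spec R).Opens} (hV : V = PrimeSpectrum.basicOpen f)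
    (x : Γ(M, V)) : ∃ (n : ℕ) (y : Γ(M, ⊤)), M.res le_top y = f ^ n • x := by
  subst hV
  let φ := ((modulesSpecToSheaf.obj M).obj.map (PrimeSpectrum.basicOpen f).leTop.op).hom
  have hl : IsLocalizedModule (.powers f) φ :=
    (isIso_fromTildeΓ_iff_isLocalizing M).mp inferInstance f
  obtain ⟨⟨y, ⟨_, n, rfl⟩⟩, hn⟩ := IsLocalizedModule.surj (.powers f) φ x
  exact ⟨n, y, hn.symm⟩

lemma fromSpec_image_top (hU : IsAffineOpen U) : U = hU.fromSpec ''ᵁ ⊤ := by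
  simp

lemma isPowerTorsion_of_isQuasicoherent (M : X.Modules) [M.IsQuasicoherent] :
    M.IsPowerTorsion := by
  intro U hU f t ht
  have e₁ := fromSpec_image_top hU
  have e₂ := (hU.fromSpec_image_basicOpen f).symm
  obtain ⟨x, rfl⟩ := (ofFromSpec_bijective M hU e₁).2 t
  rw [← M.ofFromSpec_res hU e₁.le e₂.le le_top (X.basicOpen_le f),
    ← map_zero (M.ofFromSpec hU e₂.le)] at ht
  have hx := (ofFromSpec_bijective M hU e₂).1 ht
  obtain ⟨n, hn⟩ := exists_pow_smul_eq_zero_spec _ f rfl x hx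
  refine ⟨n, ?_⟩
  have := congr(M.ofFromSpec hU e₁.le $hn)
  rw [M.ofFromSpec_smul hU e₁.le (f ^ n) x, map_zero, resHom_self] at this
  exact this

lemma isPowerExtendable_of_isQuasicoherent (M : X.Modules) [M.IsQuasicoherent] :
    M.IsPowerExtendable := by
  intro U hU f t
  have e₁ := fromSpec_image_top hU
  have e₂ := (hU.fromSpec_image_basicOpen f).symm
  obtain ⟨x, rfl⟩ := (ofFromSpec_bijective M hU e₂).2 t
  obtain ⟨n, y, hn⟩ := exists_res_eq_pow_smul_spec _ f rfl x
  refine ⟨n, M.ofFromSpec hU e₁.le y, ?_⟩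
  rw [← M.ofFromSpec_res hU e₁.le e₂.le le_top (X.basicOpen_le f), ← map_pow,
    ← M.ofFromSpec_smul hU e₂.le, hn]

lemma finite_sections_of_generatingSections (M : X.Modules) [M.IsQuasicoherent]
    (hU : IsAffineOpen U) (σ : (M.restrict hU.fromSpec).GeneratingSections) [σ.IsFiniteType] :
    Module.Finite Γ(X, U) Γ(M, U) := by
  have := finite_of_generatingSections _ σ
  have e₁ := fromSpec_image_top hU
  let φ : Γ(M.restrict hU.fromSpec, ⊤) →ₗ[Γ(X, U)] Γ(M, U) :=
    { M.ofFromSpec hU e₁.le with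
      map_smul' r x := by simpa using M.ofFromSpec_smul hU e₁.le r x }
  exact Module.Finite.of_surjective φ (ofFromSpec_bijective M hU e₁).2

end AlgebraicGeometry.Scheme.Modules

namespace AlgebraicGeometry.Scheme.Modules

variable {X : Scheme.{u}} {M N K : X.Modules} {U V W : X.Opens}

-- Restriction preserves colimits and the unit, so generators on the slice site over `W` carry over
-- to the open subscheme `V` and then to its spectrum.
open SheafOfModules in
lemma exists_generatingSections_of_isFiniteType (M : X.Modules)
    [h : SheafOfModules.IsFiniteType (R := X.ringCatSheaf) M] (x : X) :
    ∃ W : X.Opens, x ∈ W ∧ ∀ (V : X.Opens) (hV : IsAffineOpen V), V ≤ W →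
      ∃ σ : (M.restrict hV.fromSpec).GeneratingSections, σ.IsFiniteType := by
  obtain ⟨σ, hσ⟩ := h.exists_localGeneratorsData
  obtain ⟨i, hi⟩ : ∃ i, x ∈ σ.X i := by
    have := (Opens.coversTop_iff _ _).mp σ.coversTop
    have hx : x ∈ (⊤ : X.Opens) := trivial
    rw [← this] at hx
    exact TopologicalSpace.Opens.mem_iSup.mp hx
  refine ⟨σ.X i, hi, fun V hV hVW ↦ ?_⟩
  have := hσ.isFiniteType i
  let u := X.homOfLE hVW
  let F := (overEquiv (σ.X i)).functor ⋙ restrictFunctor u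
  have hF : Limits.PreservesColimitsOfSize.{u, u} F := Limits.comp_preservesColimits _ _
  let iso : SheafOfModules.overFunctor X.ringCatSheaf _ ⋙ F ≅ restrictFunctor V.ι :=
      (Functor.associator _ _ _).symm ≪≫
        Functor.isoWhiskerRight (Scheme.Modules.overFunctorEquiv _) _ ≪≫
        (restrictFunctorComp _ _).symm ≪≫ (restrictFunctorCongr (by simp [u]))
  let iso' : (M.restrict V.ι).restrict hV.isoSpec.inv ≅ M.restrict hV.fromSpec :=
    ((restrictFunctorComp _ _).app M).symm
  let F' : SheafOfModules (X.ringCatSheaf.over (σ.X i)) ⥤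
    SheafOfModules V.toScheme.ringCatSheaf := F
  have hF' : Limits.PreservesColimitsOfSize.{u, u} F' := hF
  let G := restrictFunctor hV.isoSpec.inv
  let G' : SheafOfModules V.toScheme.ringCatSheaf ⥤
    SheafOfModules (Spec Γ(X, V)).ringCatSheaf := G
  have hG : Limits.PreservesColimitsOfSize.{u, u} G := inferInstance
  have hG' : Limits.PreservesColimitsOfSize.{u, u} G' := hG
  let τ₁ := (σ.generators i).map F' (Scheme.Modules.restrictUnitIso u).symm
  have hiso : Epi (iso.app M).hom := IsIso.epi_of_iso _
  let τ₂ : (M.restrict V.ι).GeneratingSections :=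
    @GeneratingSections.ofEpi _ _ _ V.toScheme.ringCatSheaf _ _ _ _ τ₁ (iso.app M).hom hiso
  let τ₃ := τ₂.map G' (Scheme.Modules.restrictUnitIso hV.isoSpec.inv).symm
  have hiso' : Epi iso'.hom := IsIso.epi_of_iso _
  exact ⟨@GeneratingSections.ofEpi _ _ _ (Spec Γ(X, V)).ringCatSheaf _ _ _ _ τ₃ iso'.hom hiso',
    ⟨(hσ.isFiniteType i).finite⟩⟩

lemma isUnit_resHom_basicOpen (f : Γ(X, U)) : IsUnit (resHom (X.basicOpen_le f) f) :=
  RingedSpace.isUnit_res_basicOpen _ f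

lemma span_eq_top_of_forall_mem (hU : IsAffineOpen U) (t : Set Γ(X, U))
    (ht : ∀ x ∈ U, ∃ f ∈ t, x ∈ X.basicOpen f) : Ideal.span t = ⊤ := by
  rw [← hU.self_le_iSup_basicOpen_iff]
  intro x hx
  obtain ⟨f, hf, hxf⟩ := ht x hx
  exact TopologicalSpace.Opens.mem_iSup.mpr ⟨⟨f, hf⟩, hxf⟩

/-- Torsion and extendability say that `Γ(M, D(f))` is the localization of `Γ(M, U)` at `f`;
finiteness then descends from a family of `f` generating the unit ideal. -/
lemma finite_sections_of_forall_basicOpen (hU : IsAffineOpen U) (h₁ : M.IsPowerTorsion)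
    (h₂ : M.IsPowerExtendable) (t : Set Γ(X, U)) (ht : ∀ x ∈ U, ∃ f ∈ t, x ∈ X.basicOpen f)
    (h : ∀ f ∈ t, Module.Finite Γ(X, X.basicOpen f) Γ(M, X.basicOpen f)) :
    Module.Finite Γ(X, U) Γ(M, U) := by
  let (g : t) : Module Γ(X, U) Γ(M, X.basicOpen g.1) :=
    Module.compHom _ (resHom (X.basicOpen_le g.1))
  have hs (g : t) (a : Γ(X, U)) (x : Γ(M, X.basicOpen g.1)) :
    a • x = resHom (X.basicOpen_le g.1) a • x := rfl
  have (g : t) : IsScalarTower Γ(X, U) Γ(X, X.basicOpen g.1) Γ(M, X.basicOpen g.1) :=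
    IsScalarTower.of_algebraMap_smul fun _ _ ↦ rfl
  have (g : t) : IsLocalization.Away g.1 Γ(X, X.basicOpen g.1) := hU.isLocalization_basicOpen g.1
  let φ (g : t) : Γ(M, U) →ₗ[Γ(X, U)] Γ(M, X.basicOpen g.1) :=
    { M.res (X.basicOpen_le g.1) with map_smul' r x := res_smul _ r x }
  have (g : t) : IsLocalizedModule.Away g.1 (φ g) := by
    refine IsLocalizedModule.Away.mk_of_addCommGroup ?_ (fun x ↦ ?_) (h₁ U hU g.1)
    · obtain ⟨v, hv⟩ := isUnit_resHom_basicOpen g.1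
      rw [Module.End.isUnit_iff]
      refine ⟨fun x y hxy ↦ ?_, fun y ↦ ⟨(v⁻¹ : Γ(X, X.basicOpen g.1)ˣ).1 • y, ?_⟩⟩
      · rw [Module.algebraMap_end_apply, Module.algebraMap_end_apply, hs, hs, ← hv] at hxy
        exact (smul_left_cancel_iff v).mp hxy
      · rw [Module.algebraMap_end_apply, hs, ← hv]
        exact smul_inv_smul v y
    · obtain ⟨n, y, hy⟩ := h₂ U hU g.1 x
      exact ⟨n, y, by rw [hs, map_pow, ← hy]; rfl⟩
  exact Module.Finite.of_localizationSpan' t (span_eq_top_of_forall_mem hU t ht) φ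
    fun g ↦ h g.1 g.2

end AlgebraicGeometry.Scheme.Modules

namespace AlgebraicGeometry.Scheme

open Modules

lemma IsCoherentModule.isSectionwiseCoherent {X : Scheme.{u}} {M : X.Modules}
    (hM : IsCoherentModule M) : M.IsSectionwiseCoherent := by
  have hq : M.IsQuasicoherent := hM.1
  have ht := hM.2
  have h₁ := M.isPowerTorsion_of_isQuasicoherent
  have h₂ := M.isPowerExtendable_of_isQuasicoherent
  refine ⟨h₁, h₂, fun U hU ↦ ?_⟩
  refine finite_sections_of_forall_basicOpen hU h₁ h₂
    {f | Module.Finite Γ(X, X.basicOpen f) Γ(M, X.basicOpen f)} (fun x hx ↦ ?_) fun f hf ↦ hf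
  obtain ⟨W, hxW, hW⟩ := M.exists_generatingSections_of_isFiniteType x
  obtain ⟨f, hfW, hxf⟩ := hU.exists_basicOpen_le ⟨x, hxW⟩ hx
  obtain ⟨σ, hσ⟩ := hW _ (hU.basicOpen f) hfW
  exact ⟨f, M.finite_sections_of_generatingSections (hU.basicOpen f) σ, hxf⟩

end AlgebraicGeometry.Scheme

namespace AlgebraicGeometry.Scheme.Modules

variable {X : Scheme.{u}} {M N K : X.Modules} {U V W : X.Opens}

lemma isLocalizing_of_isPowerTorsion_of_isPowerExtendable (h₁ : M.IsPowerTorsion)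
    (h₂ : M.IsPowerExtendable) (hU : IsAffineOpen U) :
    IsLocalizing (modulesSpecToSheaf.obj (M.restrict hU.fromSpec)) := by
  intro f
  have e₁ := fromSpec_image_top hU
  have e₂ := (hU.fromSpec_image_basicOpen f).symm
  refine IsLocalizedModule.Away.mk_of_addCommGroup ?_ (fun x ↦ ?_) (fun x hx ↦ ?_)
  · exact isUnit_algebraMap_end_of_le_basicOpen (M := M.restrict hU.fromSpec) f le_rfl
  · obtain ⟨n, t, ht⟩ := h₂ U hU f (M.ofFromSpec hU e₂.le x)
    obtain ⟨y, rfl⟩ := (ofFromSpec_bijective M hU e₁).2 t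
    refine ⟨n, y, (ofFromSpec_bijective M hU e₂).1 ?_⟩
    refine (M.ofFromSpec_smul hU e₂.le (f ^ n) x).trans ?_
    rw [map_pow, ← ht]
    exact (M.ofFromSpec_res hU e₁.le e₂.le le_top (X.basicOpen_le f) y).symm
  · have hx' : M.res (X.basicOpen_le f) (M.ofFromSpec hU e₁.le x) = 0 :=
      (M.ofFromSpec_res hU e₁.le e₂.le le_top (X.basicOpen_le f) x).symm.trans
        ((congrArg _ hx).trans (map_zero _))
    obtain ⟨n, hn⟩ := h₁ U hU f _ hx'
    refine ⟨n, (ofFromSpec_bijective M hU e₁).1 ?_⟩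
    refine (M.ofFromSpec_smul hU e₁.le (f ^ n) x).trans ?_
    rw [resHom_self, hn]
    exact (map_zero _).symm

open SheafOfModules in
lemma exists_presentation_of_isSectionwiseCoherent (hM : M.IsSectionwiseCoherent)
    (hU : IsAffineOpen U) : ∃ σ : (M.over U).Presentation, σ.generators.IsFiniteType := by
  let R := Γ(X, U)
  let M' := M.restrict hU.fromSpec
  have hiso : IsIso M'.fromTildeΓ := (isIso_fromTildeΓ_iff_isLocalizing M').mpr
    (isLocalizing_of_isPowerTorsion_of_isPowerExtendable hM.torsion hM.extendable hU)
  let T := (modulesSpecToSheaf.obj M').presheaf.obj (.op ⊤)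
  have : Module.Finite R T := by
    have := hM.finite U hU
    have e₁ := fromSpec_image_top hU
    let φ : Γ(M.restrict hU.fromSpec, ⊤) →ₗ[Γ(X, U)] Γ(M, U) :=
      { M.ofFromSpec hU e₁.le with
        map_smul' r x := by simpa using M.ofFromSpec_smul hU e₁.le r x }
    exact Module.Finite.equiv (LinearEquiv.ofBijective φ (ofFromSpec_bijective M hU e₁)).symm
  obtain ⟨s, hs⟩ := Module.Finite.fg_top (R := R) (M := T)
  -- The whole kernel serves as the set of relations; only the generators have to be finite in
  -- number.
  let p := presentationTilde T (s : Set T) hs _ (Submodule.span_eq _)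
  have hp : p.generators.IsFiniteType := ⟨inferInstanceAs (Finite (s : Set T))⟩
  let p₁ : M'.Presentation := @Presentation.ofIsIso _ _ _ (Spec R).ringCatSheaf _ _ _ _
    M'.fromTildeΓ hiso p
  let p₂ := presentationRestrict hU.isoSpec.hom p₁
  let i₃ : M'.restrict hU.isoSpec.hom ≅ M.restrict U.ι :=
    ((restrictFunctorComp _ _).app M).symm ≪≫ (restrictFunctorCongr (by simp)).app M
  have h₃ : IsIso i₃.hom := inferInstance
  let p₃ : (M.restrict U.ι).Presentation := @Presentation.ofIsIso _ _ _ U.toScheme.ringCatSheaf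
    _ _ _ _ i₃.hom h₃ p₂
  let F : SheafOfModules U.toScheme.ringCatSheaf ⥤ SheafOfModules (X.ringCatSheaf.over U) :=
    (overEquiv U).inverse
  have hF : Limits.PreservesColimitsOfSize.{u, u} (overEquiv U).inverse := inferInstance
  have hF' : Limits.PreservesColimitsOfSize.{u, u} F := hF
  let p₄ := p₃.map F (U.sheafOfModulesEquivOverInverseUnit _).symm
  let i₅ : (overEquiv U).inverse.obj (M.restrict U.ι) ≅ M.over U :=
    (overEquiv U).inverse.mapIso ((overFunctorEquiv U).app M).symm ≪≫
      ((overEquiv U).unitIso.app (M.over U)).symm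
  have h₅ : IsIso i₅.hom := inferInstance
  refine ⟨Presentation.ofIsIso i₅.hom p₄, ⟨?_⟩⟩
  exact hp.finite

end AlgebraicGeometry.Scheme.Modules

namespace AlgebraicGeometry.Scheme

open Modules SheafOfModules

variable {X : Scheme.{u}} {M : X.Modules}

lemma Modules.IsSectionwiseCoherent.isCoherentModule (hM : M.IsSectionwiseCoherent) :
    IsCoherentModule M := by
  choose σ hσ using fun U : X.affineOpens ↦ exists_presentation_of_isSectionwiseCoherent hM U.2
  have hc : (Opens.grothendieckTopology X).CoversTop fun U : X.affineOpens ↦ U.1 :=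
    (Opens.coversTop_iff _ _).mpr (iSup_affineOpens_eq_top X)
  let q : QuasicoherentData (R := X.ringCatSheaf) M :=
    { I := X.affineOpens
      X U := U.1
      coversTop := hc
      presentation := σ }
  have hq : q.localGeneratorsData.IsFiniteType := by
    constructor
    exact hσ
  refine ⟨q.isQuasicoherent, ?_⟩
  constructor
  exact ⟨q.localGeneratorsData, hq⟩

/-- A module is coherent if and only if it is so in terms of its sections over affine opens. -/
lemma isCoherentModule_iff : IsCoherentModule M ↔ M.IsSectionwiseCoherent :=
  ⟨fun h ↦ h.isSectionwiseCoherent, fun h ↦ h.isCoherentModule⟩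

end AlgebraicGeometry.Scheme

/-! ### Kernels, cokernels and extensions of coherent modules. -/

namespace AlgebraicGeometry.Scheme.Modules

variable {X : Scheme.{u}} {M N K : X.Modules} {U V W : X.Opens}

lemma pow_smul_eq_zero_of_le {R A : Type*} [CommRing R] [AddCommGroup A] [Module R A] {f : R} {e : A}
    {n m : ℕ} (h : n ≤ m) (he : f ^ n • e = 0) : f ^ m • e = 0 := by
  rw [← Nat.sub_add_cancel h, pow_add, mul_smul, he, smul_zero]

lemma IsPowerTorsion.exists_pow_smul_eq_zero (hM : M.IsPowerTorsion) (hV : IsAffineOpen V)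
    (h : V ≤ U) (f : Γ(X, U)) (e : Γ(M, V)) (hWV : W ≤ V) (hW : V ⊓ X.basicOpen f ≤ W)
    (he : M.res hWV e = 0) : ∃ n : ℕ, resHom h f ^ n • e = 0 := by
  refine hM V hV _ e ?_
  have h' : X.basicOpen (resHom h f) ≤ W := by
    rw [resHom, X.basicOpen_res]
    exact hW
  rw [← res_res hWV h', he, map_zero]

lemma IsPowerExtendable.exists_res_eq (hM : M.IsPowerExtendable) (hV : IsAffineOpen V)
    (h : V ≤ U) (f : Γ(X, U)) (hW : W = V ⊓ X.basicOpen f) (s : Γ(M, W)) :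
    ∃ (n : ℕ) (t : Γ(M, V)), M.res (hW.le.trans inf_le_left) t =
      resHom ((hW.le.trans inf_le_left).trans h) f ^ n • s := by
  have h' : W = X.basicOpen (resHom h f) := by
    rw [resHom, X.basicOpen_res, hW]
  subst h'
  obtain ⟨n, t, ht⟩ := hM V hV _ s
  exact ⟨n, t, by rw [ht, resHom_resHom]⟩

lemma exists_pow_smul_eq_zero_of_locally (hU : IsCompact (U : Set X)) (f : Γ(X, U)) (e : Γ(M, U))
    (h : ∀ x ∈ U, ∃ (V : X.Opens) (hV : V ≤ U), x ∈ V ∧ ∃ n : ℕ,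
      resHom hV f ^ n • M.res hV e = 0) : ∃ n : ℕ, f ^ n • e = 0 := by
  choose V hV hx n hn using h
  obtain ⟨t, ht⟩ := hU.elim_finite_subcover (fun x : U ↦ (V x.1 x.2 : Set X))
    (fun x ↦ (V x.1 x.2).isOpen) fun x hxU ↦ Set.mem_iUnion.mpr ⟨⟨x, hxU⟩, hx x hxU⟩
  refine ⟨t.sup fun x ↦ n x.1 x.2, res_ext (fun x : t ↦ V x.1.1 x.1.2)
    (fun x ↦ hV x.1.1 x.1.2) (fun x hxU ↦ ?_) fun x ↦ ?_⟩
  · obtain ⟨y, hy, hxy⟩ := Set.mem_iUnion₂.mp (ht hxU)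
    exact TopologicalSpace.Opens.mem_iSup.mpr ⟨⟨y, hy⟩, hxy⟩
  · rw [res_smul, map_pow, map_zero]
    exact pow_smul_eq_zero_of_le (Finset.le_sup (f := fun x : U ↦ n x.1 x.2) x.2) (hn _ _)

lemma IsPowerTorsion.of_mono (φ : M ⟶ N) [Mono φ] (hN : N.IsPowerTorsion) :
    M.IsPowerTorsion := by
  intro U hU f t ht
  obtain ⟨n, hn⟩ := hN U hU f (φ.app U t) (by rw [← app_res, ht, map_zero])
  refine ⟨n, app_injective φ U ?_⟩
  rw [app_smul, hn, map_zero]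

/-- A morphism on sections over an open subset, as a linear map. -/
noncomputable def appₗ (φ : M ⟶ N) (U : X.Opens) : Γ(M, U) →ₗ[Γ(X, U)] Γ(N, U) :=
  { (φ.app U).hom with map_smul' r x := app_smul φ r x }

lemma appₗ_apply (φ : M ⟶ N) (x : Γ(M, U)) : appₗ φ U x = φ.app U x := rfl

section ShortComplex

variable {S : ShortComplex X.Modules}

/-- The kernel of a morphism from a coherent module to a module with power torsion is coherent. -/
lemma IsSectionwiseCoherent.of_exact_of_mono [IsLocallyNoetherian X] (hS : S.Exact) [Mono S.f]
    (h₂ : S.X₂.IsSectionwiseCoherent) (h₃ : S.X₃.IsPowerTorsion) :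
    S.X₁.IsSectionwiseCoherent where
  torsion := .of_mono S.f h₂.torsion
  extendable U hU f s := by
    obtain ⟨n, b, hb⟩ := h₂.extendable U hU f (S.f.app _ s)
    obtain ⟨m, hm⟩ := h₃ U hU f (S.g.app _ b) (by
      rw [← app_res, hb, app_smul, app_f_g, smul_zero])
    obtain ⟨a, ha⟩ := exists_app_eq_of_exact hS (f ^ m • b) (by rw [app_smul, hm])
    refine ⟨m + n, a, app_injective S.f _ ?_⟩
    rw [app_res, ha, res_smul, hb, app_smul, map_pow, pow_add, mul_smul]
  finite U hU := by
    have := IsLocallyNoetherian.component_noetherian ⟨U, hU⟩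
    have := h₂.finite U hU
    have : _root_.IsNoetherian Γ(X, U) Γ(S.X₂, U) := isNoetherian_of_isNoetherianRing_of_finite _ _
    exact Module.Finite.of_injective (appₗ S.f U) (app_injective S.f U)

lemma exists_basicOpen_preimage [Epi S.g] (hU : IsAffineOpen U) (s : Γ(S.X₃, U)) {x : X}
    (hx : x ∈ U) : ∃ (g : Γ(X, U)) (t : Γ(S.X₂, X.basicOpen g)), x ∈ X.basicOpen g ∧
      S.g.app _ t = S.X₃.res (X.basicOpen_le g) s := by
  obtain ⟨V, hV, t, hxV, ht⟩ := exists_local_preimage S.g s hx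
  obtain ⟨g, hg, hxg⟩ := hU.exists_basicOpen_le ⟨x, hxV⟩ hx
  exact ⟨g, S.X₂.res hg t, hxg, by rw [app_res, ht, res_res]⟩

/-- Lift `e` locally to `m`. On `D(f)` the lift comes from a section `k` of the submodule, and some
`f ^ n • k` extends to `k'`. Then `f ^ n • m` minus the image of `k'` vanishes on `D(f)`, so a power
of `f` kills it, and its image is `f ^ n • e`. -/
lemma IsPowerTorsion.of_shortExact_cokernel (hS : S.ShortExact) (h₁ : S.X₁.IsPowerExtendable)
    (h₂ : S.X₂.IsPowerTorsion) : S.X₃.IsPowerTorsion := by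
  intro U hU f e he
  have := hS.epi_g
  have := hS.mono_f
  refine exists_pow_smul_eq_zero_of_locally hU.isCompact f e fun x hx ↦ ?_
  obtain ⟨g, m, hxg, hm⟩ := exists_basicOpen_preimage hU e hx
  refine ⟨_, X.basicOpen_le g, hxg, ?_⟩
  let W : X.Opens := X.basicOpen g ⊓ X.basicOpen f
  obtain ⟨k, hk⟩ := exists_app_eq_of_exact hS.exact (S.X₂.res (inf_le_left : W ≤ _) m) (by
    rw [app_res, hm, res_res, ← res_res (X.basicOpen_le f) (inf_le_right : W ≤ _), he, map_zero])
  obtain ⟨n, k', hk'⟩ := h₁.exists_res_eq (hU.basicOpen g) (X.basicOpen_le g) f rfl k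
  obtain ⟨p, hp⟩ := h₂.exists_pow_smul_eq_zero (hU.basicOpen g) (X.basicOpen_le g) f
    (resHom (X.basicOpen_le g) f ^ n • m - S.f.app _ k') (inf_le_left : W ≤ _) le_rfl (by
      rw [map_sub, res_smul, ← app_res, hk', app_smul, hk, map_pow, resHom_resHom, sub_self])
  refine ⟨p + n, ?_⟩
  have := congr(S.g.app _ $hp)
  rwa [app_smul, map_sub, app_smul, app_f_g, sub_zero, map_zero, hm, ← mul_smul,
    ← pow_add] at this

/-- Sections over an affine open lift along an epimorphism with coherent kernel. -/
lemma surjective_app_of_shortExact (hS : S.ShortExact) (h₁ : S.X₁.IsPowerExtendable)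
    (h₂ : S.X₂.IsPowerTorsion) (h₂' : S.X₂.IsPowerExtendable) (hU : IsAffineOpen U) :
    Function.Surjective (S.g.app U) := by
  intro s
  have := hS.epi_g
  have h₃ := IsPowerTorsion.of_shortExact_cokernel hS h₁ h₂
  -- A substitute for the vanishing of `H¹(U, S.X₁)`: the `f` for which `s` lifts over `D(f)`
  -- generate the unit ideal, so it is enough that a power of each of them moves `s` into the range.
  let A : Set Γ(X, U) :=
    {f | ∃ t, S.g.app _ t = S.X₃.res (X.basicOpen_le f) s}
  have hA : Ideal.span A = ⊤ := span_eq_top_of_forall_mem hU A fun x hx ↦ by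
    obtain ⟨g, t, hxg, ht⟩ := exists_basicOpen_preimage hU s hx
    exact ⟨g, ⟨t, ht⟩, hxg⟩
  refine Submodule.mem_of_span_eq_top_of_smul_pow_mem (LinearMap.range (appₗ S.g U)) A hA s ?_
  rintro ⟨f, t, ht⟩
  obtain ⟨n, t', ht'⟩ := h₂' U hU f t
  obtain ⟨m, hm⟩ := h₃ U hU f (S.g.app _ t' - f ^ n • s) (by
    rw [map_sub, ← app_res, ht', app_smul, ht, res_smul, map_pow, sub_self])
  refine ⟨m + n, f ^ m • t', ?_⟩
  rw [appₗ_apply, app_smul, pow_add, mul_smul, ← sub_eq_zero, ← smul_sub, hm]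

/-- The cokernel of a monomorphism of coherent modules is coherent. -/
lemma IsSectionwiseCoherent.of_shortExact_cokernel (hS : S.ShortExact)
    (h₁ : S.X₁.IsSectionwiseCoherent) (h₂ : S.X₂.IsSectionwiseCoherent) :
    S.X₃.IsSectionwiseCoherent where
  torsion := .of_shortExact_cokernel hS h₁.extendable h₂.torsion
  extendable U hU f s := by
    obtain ⟨t, rfl⟩ := surjective_app_of_shortExact hS h₁.extendable h₂.torsion h₂.extendable
      (hU.basicOpen f) s
    obtain ⟨n, t', ht'⟩ := h₂.extendable U hU f t
    exact ⟨n, S.g.app _ t', by rw [← app_res, ht', app_smul]⟩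
  finite U hU := by
    have := h₂.finite U hU
    exact Module.Finite.of_surjective (appₗ S.g U)
      (surjective_app_of_shortExact hS h₁.extendable h₂.torsion h₂.extendable hU)

lemma IsPowerTorsion.of_shortExact_extension (hS : S.ShortExact) (h₁ : S.X₁.IsPowerTorsion)
    (h₃ : S.X₃.IsPowerTorsion) : S.X₂.IsPowerTorsion := by
  intro U hU f t ht
  have := hS.mono_f
  obtain ⟨n, hn⟩ := h₃ U hU f (S.g.app U t) (by rw [← app_res, ht, map_zero])
  obtain ⟨a, ha⟩ := exists_app_eq_of_exact hS.exact (f ^ n • t) (by rw [app_smul, hn])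
  obtain ⟨m, hm⟩ := h₁ U hU f a (app_injective S.f _ (by
    rw [app_res, ha, res_smul, ht, smul_zero, map_zero]))
  refine ⟨m + n, ?_⟩
  rw [pow_add, mul_smul, ← ha, ← app_smul, hm, map_zero]

/-- Sections over `D(f)` extend after multiplication by a power of `f` if they do so locally. -/
lemma exists_res_eq_pow_smul_of_locally (hM : M.IsPowerTorsion) (hU : IsAffineOpen U)
    (f : Γ(X, U)) (t : Γ(M, X.basicOpen f))
    (h : ∀ x ∈ U, ∃ (g : Γ(X, U)) (n : ℕ) (m : Γ(M, X.basicOpen g)), x ∈ X.basicOpen g ∧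
      M.res (inf_le_left : X.basicOpen g ⊓ X.basicOpen f ≤ _) m =
        M.res inf_le_right (resHom (X.basicOpen_le f) f ^ n • t)) :
    ∃ (n : ℕ) (b : Γ(M, U)),
      M.res (X.basicOpen_le f) b = resHom (X.basicOpen_le f) f ^ n • t := by
  choose g n m hx hm using h
  obtain ⟨c, hc⟩ := hU.isCompact.elim_finite_subcover
    (fun x : U ↦ (X.basicOpen (g x.1 x.2) : Set X)) (fun x ↦ (X.basicOpen _).isOpen)
    fun x hxU ↦ Set.mem_iUnion.mpr ⟨⟨x, hxU⟩, hx x hxU⟩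
  let G (x : c) : Γ(X, U) := g x.1.1 x.1.2
  have hcov : U ≤ ⨆ x : c, X.basicOpen (G x) := fun x hxU ↦ by
    obtain ⟨y, hy, hxy⟩ := Set.mem_iUnion₂.mp (hc hxU)
    exact TopologicalSpace.Opens.mem_iSup.mpr ⟨⟨y, hy⟩, hxy⟩
  let P : ℕ := c.sup fun x ↦ n x.1 x.2
  obtain ⟨m', hm'⟩ : ∃ m' : ∀ x : c, Γ(M, X.basicOpen (G x)), ∀ x,
      M.res (inf_le_left : X.basicOpen (G x) ⊓ X.basicOpen f ≤ _) (m' x) =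
        M.res inf_le_right (resHom (X.basicOpen_le f) f ^ P • t) := by
    refine ⟨fun x ↦ resHom (X.basicOpen_le (G x)) f ^ (P - n x.1.1 x.1.2) • m x.1.1 x.1.2,
      fun x ↦ ?_⟩
    have hle : n x.1.1 x.1.2 ≤ P := Finset.le_sup (f := fun x : U ↦ n x.1 x.2) x.2
    rw [res_smul, hm, ← Nat.sub_add_cancel hle, pow_add, mul_smul, Nat.sub_add_cancel hle,
      res_smul _ (resHom _ f ^ (P - _)), map_pow, map_pow, resHom_resHom, resHom_resHom]
  -- The local extensions agree on `D(f)`, so a power of `f` kills their differences on overlaps;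
  -- after multiplication by a common power `f ^ Q` they glue.
  have hq (x y : c) : ∃ q : ℕ, resHom (inf_le_left.trans (X.basicOpen_le (G x)) :
      X.basicOpen (G x) ⊓ X.basicOpen (G y) ≤ U) f ^ q • (M.res (inf_le_left : X.basicOpen (G x) ⊓ X.basicOpen (G y) ≤ _) (m' x) -
        M.res inf_le_right (m' y)) = 0 := by
    have haff : IsAffineOpen (X.basicOpen (G x) ⊓ X.basicOpen (G y)) := by
      rw [← X.basicOpen_mul]
      exact hU.basicOpen _
    refine hM.exists_pow_smul_eq_zero haff _ f _
      (inf_le_left : X.basicOpen (G x) ⊓ X.basicOpen (G y) ⊓ X.basicOpen f ≤ _) le_rfl ?_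
    have e₁ := congr(M.res (inf_le_inf_right _ inf_le_left :
      X.basicOpen (G x) ⊓ X.basicOpen (G y) ⊓ X.basicOpen f ≤ _) $(hm' x))
    have e₂ := congr(M.res (inf_le_inf_right _ inf_le_right :
      X.basicOpen (G x) ⊓ X.basicOpen (G y) ⊓ X.basicOpen f ≤ _) $(hm' y))
    rw [res_res, res_res] at e₁ e₂
    rw [map_sub, res_res, res_res, e₁, e₂, sub_self]
  choose q hq using hq
  let Q : ℕ := Finset.univ.sup fun x : c × c ↦ q x.1 x.2
  obtain ⟨b, hb⟩ := exists_glue (fun x : c ↦ X.basicOpen (G x)) (fun x ↦ X.basicOpen_le _) hcov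
    (fun x ↦ resHom (X.basicOpen_le (G x)) f ^ Q • m' x) fun x y ↦ by
      have hle : q x y ≤ Q :=
        Finset.le_sup (f := fun x : c × c ↦ q x.1 x.2) (Finset.mem_univ (x, y))
      rw [res_smul, res_smul, map_pow, map_pow, resHom_resHom, resHom_resHom, ← sub_eq_zero,
        ← smul_sub]
      exact pow_smul_eq_zero_of_le hle (hq x y)
  refine ⟨Q + P, b, res_ext (fun x : c ↦ X.basicOpen (G x) ⊓ X.basicOpen f)
    (fun x ↦ inf_le_right) (fun x hx ↦ ?_) fun x ↦ ?_⟩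
  · obtain ⟨y, hy⟩ := TopologicalSpace.Opens.mem_iSup.mp (hcov (X.basicOpen_le f hx))
    exact TopologicalSpace.Opens.mem_iSup.mpr ⟨y, hy, hx⟩
  · rw [res_res, ← res_res (X.basicOpen_le (G x)) inf_le_left, hb, res_smul, hm', pow_add,
      mul_smul, res_smul _ (resHom _ f ^ Q), map_pow, map_pow, resHom_resHom, resHom_resHom]

/-- An extension of coherent modules is coherent. -/
lemma IsSectionwiseCoherent.of_shortExact_extension [IsLocallyNoetherian X] (hS : S.ShortExact)
    (h₁ : S.X₁.IsSectionwiseCoherent) (h₃ : S.X₃.IsSectionwiseCoherent) :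
    S.X₂.IsSectionwiseCoherent where
  torsion := .of_shortExact_extension hS h₁.torsion h₃.torsion
  extendable U hU f t := by
    have := hS.epi_g
    have := hS.mono_f
    obtain ⟨n, s, hs⟩ := h₃.extendable U hU f (S.g.app _ t)
    refine exists_res_eq_pow_smul_of_locally
      (.of_shortExact_extension hS h₁.torsion h₃.torsion) hU f t fun x hx ↦ ?_
    obtain ⟨g, m, hxg, hm⟩ := exists_basicOpen_preimage hU s hx
    let W : X.Opens := X.basicOpen g ⊓ X.basicOpen f
    -- Both `m` and `f ^ n • t` lift the restriction of `s`, so they differ by a section `k` of the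
    -- submodule. An extension of `f ^ p • k` is the correction to subtract from `f ^ p • m`.
    obtain ⟨k, hk⟩ := exists_app_eq_of_exact hS.exact
      (S.X₂.res (inf_le_left : W ≤ _) m -
        S.X₂.res inf_le_right (resHom (X.basicOpen_le f) f ^ n • t)) (by
      rw [map_sub, app_res, hm, app_res, app_smul, ← hs, res_res, res_res, sub_self])
    obtain ⟨p, k', hk'⟩ := h₁.extendable.exists_res_eq (hU.basicOpen g) (X.basicOpen_le g) f rfl k
    refine ⟨g, p + n, resHom (X.basicOpen_le g) f ^ p • m - S.f.app _ k', hxg, ?_⟩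
    rw [map_sub, res_smul, ← app_res, hk', app_smul, hk, map_pow, resHom_resHom, smul_sub,
      sub_sub_cancel, pow_add, mul_smul, res_smul _ (resHom _ f ^ p), map_pow, resHom_resHom]
  finite U hU := by
    have := hS.mono_f
    have := IsLocallyNoetherian.component_noetherian ⟨U, hU⟩
    have := h₁.finite U hU
    have := h₃.finite U hU
    have : _root_.IsNoetherian Γ(X, U) Γ(S.X₁, U) := isNoetherian_of_isNoetherianRing_of_finite _ _
    have : _root_.IsNoetherian Γ(X, U) Γ(S.X₃, U) := isNoetherian_of_isNoetherianRing_of_finite _ _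
    have : _root_.IsNoetherian Γ(X, U) Γ(S.X₂, U) :=
      isNoetherian_of_range_eq_ker (appₗ S.f U) (appₗ S.g U) (by
        ext x
        refine ⟨?_, fun hx ↦ exists_app_eq_of_exact hS.exact x hx⟩
        rintro ⟨y, rfl⟩
        exact app_f_g S y)
    infer_instance

end ShortComplex

end AlgebraicGeometry.Scheme.Modules

/-! ### Structure sheaves of integral closed subschemes. -/

namespace AlgebraicGeometry.Scheme

variable {X : Scheme.{u}} {U V W : X.Opens}

namespace Modules

variable {M N K : X.Modules}

/-- The structure sheaf as a sheaf of modules. -/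
noncomputable abbrev structureModule (X : Scheme.{u}) : X.Modules :=
  SheafOfModules.unit X.ringCatSheaf

/-- The morphism from the structure sheaf given by a global section. -/
noncomputable def homOfSection (s : Γ(M, ⊤)) : structureModule X ⟶ M where
  val :=
  { app V := ModuleCat.ofHom (Y := M.val.obj V) (X := ModuleCat.of (X.ringCatSheaf.obj.obj V) _)
      (LinearMap.toSpanSingleton Γ(X, V.unop) Γ(M, V.unop) (M.res le_top s))
    naturality {V W} i := by
      obtain ⟨V⟩ := V
      obtain ⟨W⟩ := W
      refine ModuleCat.hom_ext (LinearMap.ext fun (a : Γ(X, V)) ↦ ?_)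
      have h : W ≤ V := leOfHom i.unop
      have := (M.res_smul h a (M.res le_top s)).symm
      rw [res_res] at this
      exact this }

lemma homOfSection_app (s : Γ(M, ⊤)) (a : Γ(X, U)) :
    (homOfSection s).app U a = a • M.res le_top s := rfl

lemma epi_of_exists_local_preimage (φ : M ⟶ N)
    (h : ∀ (U : X.Opens) (s : Γ(N, U)) (x : X), x ∈ U → ∃ (V : X.Opens) (hV : V ≤ U) (t : Γ(M, V)),
      x ∈ V ∧ φ.app V t = N.res hV s) : Epi φ := by
  refine ⟨fun {K} f g hfg ↦ hom_ext _ _ fun U ↦ AddCommGrpCat.ext fun s ↦ ?_⟩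
  refine res_ext_of_mem fun x hx ↦ ?_
  obtain ⟨V, hV, t, hxV, ht⟩ := h U s x hx
  refine ⟨V, hV, hxV, ?_⟩
  rw [← app_res, ← app_res, ← ht, ← app_comp_apply, hfg, app_comp_apply]

lemma isSectionwiseCoherent_structureModule (X : Scheme.{u}) :
    (structureModule X).IsSectionwiseCoherent where
  torsion U hU f t ht := by
    have := hU.isLocalization_basicOpen f
    obtain ⟨⟨_, n, rfl⟩, hn⟩ := (IsLocalization.map_eq_zero_iff (.powers f) Γ(X, X.basicOpen f) t).mp ht
    exact ⟨n, hn⟩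
  extendable U hU f s := by
    have := hU.isLocalization_basicOpen f
    obtain ⟨⟨t, ⟨_, n, rfl⟩⟩, hn⟩ := IsLocalization.surj (.powers f) s (S := Γ(X, X.basicOpen f))
    refine ⟨n, t, hn.symm.trans ?_⟩
    refine (mul_comm _ _).trans ?_
    exact congrArg (· * (show Γ(X, X.basicOpen f) from s)) (map_pow (resHom (X.basicOpen_le f)) f n)
  finite U hU := inferInstanceAs (Module.Finite Γ(X, U) Γ(X, U))

variable {Z : Scheme.{u}} (i : Z ⟶ X)

lemma isPowerTorsion_pushforward [IsAffineHom i] {F : Z.Modules} (hF : F.IsPowerTorsion) :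
    ((Modules.pushforward i).obj F).IsPowerTorsion := by
  intro U hU f t ht
  have h : Z.basicOpen (i.app U f) ≤ i ⁻¹ᵁ X.basicOpen f := (i.preimage_basicOpen f).ge
  obtain ⟨n, hn⟩ := hF (i ⁻¹ᵁ U) (hU.preimage i) (i.app U f) t (by
    exact (F.res_res ((TopologicalSpace.Opens.map i.base).map (homOfLE (X.basicOpen_le f))).le h
      (show Γ(F, i ⁻¹ᵁ U) from t)).symm.trans ((congrArg (F.res h) ht).trans (map_zero _)))
  refine ⟨n, ?_⟩
  rw [← map_pow] at hn
  exact hn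

lemma app_surjective_of_isClosedImmersion [IsClosedImmersion i] (hU : IsAffineOpen U) :
    Function.Surjective (i.app U) := by
  have h := i.toImage_imageι
  have h₁ : Function.Surjective (i.imageι.app U) := i.ker.subschemeι_app_surjective ⟨U, hU⟩
  have h₂ : Function.Surjective (i.toImage.app (i.imageι ⁻¹ᵁ U)) :=
    (ConcreteCategory.bijective_of_isIso _).2
  have h₃ : Function.Surjective ((i.toImage ≫ i.imageι).app U) := by
    rw [Scheme.Hom.comp_app]
    exact h₂.comp h₁
  rwa [h] at h₃

/-- The canonical morphism from the structure sheaf to the pushforward of the structure sheaf. -/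
noncomputable def toPushforward : structureModule X ⟶ (Modules.pushforward i).obj (structureModule Z) :=
  homOfSection (M := (Modules.pushforward i).obj (structureModule Z)) (1 : Γ(Z, i ⁻¹ᵁ ⊤))

lemma toPushforward_app (a : Γ(X, U)) : (toPushforward i).app U a = i.app U a := by
  refine (homOfSection_app _ _).trans ?_
  exact (congrArg (i.app U a * ·)
    (map_one (resHom (show i ⁻¹ᵁ U ≤ i ⁻¹ᵁ ⊤ from le_top)))).trans (mul_one _)

instance epi_toPushforward [IsClosedImmersion i] : Epi (toPushforward i) := by
  refine epi_of_exists_local_preimage _ fun U s x hx ↦ ?_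
  obtain ⟨V, hV, hxV, hVU⟩ := X.isBasis_affineOpens.exists_subset_of_mem_open hx U.isOpen
  obtain ⟨V, hV, rfl⟩ := hV
  obtain ⟨t, ht⟩ := app_surjective_of_isClosedImmersion i hV
    (((Modules.pushforward i).obj (structureModule Z)).res hVU s)
  exact ⟨V, hVU, t, hxV, (toPushforward_app i t).trans ht⟩

lemma isPowerTorsion_pushforward_structureModule [IsClosedImmersion i] :
    ((Modules.pushforward i).obj (structureModule Z)).IsPowerTorsion :=
  isPowerTorsion_pushforward i (isSectionwiseCoherent_structureModule Z).torsion

lemma shortExact_kernel {M N : X.Modules} (f : M ⟶ N) [Epi f] :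
    (ShortComplex.mk (Limits.kernel.ι f) f (Limits.kernel.condition f)).ShortExact where
  exact := ShortComplex.exact_kernel f

lemma shortExact_cokernel {M N : X.Modules} (f : M ⟶ N) [Mono f] :
    (ShortComplex.mk f (Limits.cokernel.π f) (Limits.cokernel.condition f)).ShortExact where
  exact := ShortComplex.exact_cokernel f

lemma IsSectionwiseCoherent.kernel [IsLocallyNoetherian X] (hM : M.IsSectionwiseCoherent)
    (hN : N.IsPowerTorsion) (f : M ⟶ N) : (Limits.kernel f).IsSectionwiseCoherent :=
  .of_exact_of_mono (ShortComplex.exact_kernel f) hM hN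

/-- Torsion of `N` is enough to make the kernel coherent, and a quotient of coherent modules is
coherent. This yields coherence of `i_* 𝒪_Z`, a quotient of `𝒪_X`. -/
lemma IsSectionwiseCoherent.of_epi [IsLocallyNoetherian X] (hM : M.IsSectionwiseCoherent)
    (hN : N.IsPowerTorsion) (f : M ⟶ N) [Epi f] : N.IsSectionwiseCoherent :=
  .of_shortExact_cokernel (shortExact_kernel f) (hM.kernel hN f) hM

lemma IsSectionwiseCoherent.image [IsLocallyNoetherian X] (hM : M.IsSectionwiseCoherent)
    (hN : N.IsPowerTorsion) (f : M ⟶ N) : (Abelian.image f).IsSectionwiseCoherent :=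
  hM.of_epi (.of_mono (Abelian.image.ι f) hN) (Abelian.factorThruImage f)

lemma IsSectionwiseCoherent.cokernel [IsLocallyNoetherian X] (hM : M.IsSectionwiseCoherent)
    (hN : N.IsSectionwiseCoherent) (f : M ⟶ N) : (Limits.cokernel f).IsSectionwiseCoherent :=
  .of_shortExact_cokernel (shortExact_kernel (Limits.cokernel.π f)) (hM.image hN.torsion f) hN

lemma IsSectionwiseCoherent.of_iso [IsLocallyNoetherian X] (hM : M.IsSectionwiseCoherent)
    (e : M ≅ N) : N.IsSectionwiseCoherent :=
  hM.of_epi (.of_mono e.inv hM.torsion) e.hom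

lemma IsSectionwiseCoherent.of_isZero [IsLocallyNoetherian X] (hM : Limits.IsZero M) :
    M.IsSectionwiseCoherent :=
  ((isSectionwiseCoherent_structureModule X).kernel
    (isSectionwiseCoherent_structureModule X).torsion (𝟙 _)).of_iso
    (Limits.IsZero.iso (Limits.isZero_kernel_of_mono _) hM)

lemma isSectionwiseCoherent_pushforward_structureModule [IsLocallyNoetherian X] [IsClosedImmersion i] :
    ((Modules.pushforward i).obj (structureModule Z)).IsSectionwiseCoherent :=
  (isSectionwiseCoherent_structureModule X).of_epi (isPowerTorsion_pushforward_structureModule i)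
    (toPushforward i)

end Modules

/-- `Z` is the scheme-theoretic image of `Spec κ(x)`. It is reduced because its functions over
affine opens of `X` inject into functions on the spectrum of a field, and irreducible because it has
a dense point. -/
lemma exists_isIntegral_range_eq_closure [AlgebraicGeometry.IsNoetherian X] (x : X) :
    ∃ (Z : Scheme.{u}) (i : Z ⟶ X), IsClosedImmersion i ∧ IsIntegral Z ∧
      Set.range i = closure {x} := by
  let f := X.fromSpecResidueField x
  have hf : QuasiCompact f := inferInstance
  have hr : IsReduced f.image := by
    refine ⟨fun U ↦ ⟨fun s hs ↦ ?_⟩⟩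
    refine Modules.res_ext_of_mem (M := Modules.structureModule f.image) fun z hz ↦ ?_
    obtain ⟨_, ⟨_, ⟨V, hV, rfl⟩, rfl⟩, hzV, hVU⟩ := (X.isBasis_affineOpens.of_isInducing
        f.imageι.isEmbedding.isInducing).exists_subset_of_mem_open hz U.isOpen
    let W : f.image.Opens := f.imageι ⁻¹ᵁ V
    have hWU : W ≤ U := hVU
    refine ⟨W, hWU, hzV, ?_⟩
    refine (f.toImage_app_injective ⟨V, hV⟩ ?_ : resHom hWU s = 0).trans (map_zero _).symm
    rw [map_zero]
    exact ((hs.map (resHom hWU)).map (f.toImage.app W).hom).eq_zero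
  have hd : DenseRange f.toImage := f.toImage.denseRange
  have : IrreducibleSpace f.image := by
    have h := ((IrreducibleSpace.isIrreducible_univ _).image f.toImage
      f.toImage.continuous.continuousOn).closure
    rw [Set.image_univ, hd.closure_range] at h
    exact (irreducibleSpace_def _).mpr h
  exact ⟨f.image, f.imageι, inferInstance, isIntegral_of_irreducibleSpace_of_isReduced _, by
    rw [Hom.imageι, IdealSheafData.range_subschemeι, Hom.support_ker, X.range_fromSpecResidueField]⟩

end AlgebraicGeometry.Scheme

/-! ### Vanishing on open sets, and pushforward of the restriction to an open set. -/

namespace AlgebraicGeometry.Scheme.Modules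

variable {X : Scheme.{u}} {M N K : X.Modules} {U V W O : X.Opens}

/-- The restriction of a sheaf of modules to an open subset is zero. -/
def VanishesOn (M : X.Modules) (O : X.Opens) : Prop :=
  ∀ (V : X.Opens), V ≤ O → ∀ s : Γ(M, V), s = 0

lemma VanishesOn.mono (h : M.VanishesOn O) (hV : V ≤ O) : M.VanishesOn V :=
  fun _ hW s ↦ h _ (hW.trans hV) s

lemma VanishesOn.sSup {S : Set X.Opens} (h : ∀ O ∈ S, M.VanishesOn O) : M.VanishesOn (sSup S) := by
  intro V hV _
  refine res_ext_of_mem fun x hx ↦ ?_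
  obtain ⟨O, hO, hxO⟩ := TopologicalSpace.Opens.mem_sSup.mp (hV hx)
  exact ⟨V ⊓ O, inf_le_left, ⟨hx, hxO⟩, (h O hO _ inf_le_right _).trans
    (h O hO _ inf_le_right _).symm⟩

lemma VanishesOn.sup (h : M.VanishesOn U) (h' : M.VanishesOn V) : M.VanishesOn (U ⊔ V) := by
  rw [← sSup_pair]
  exact .sSup (by simp [h, h'])

lemma VanishesOn.of_mono (φ : M ⟶ N) [Mono φ] (h : N.VanishesOn O) : M.VanishesOn O :=
  fun V hV _ ↦ app_injective φ V ((h V hV _).trans (map_zero _).symm)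

lemma VanishesOn.of_epi (φ : M ⟶ N) [Epi φ] (h : M.VanishesOn O) : N.VanishesOn O := by
  intro V hV s
  refine res_ext_of_mem fun x hx ↦ ?_
  obtain ⟨W, hW, t, hxW, ht⟩ := exists_local_preimage φ s hx
  exact ⟨W, hW, hxW, by rw [← ht, h W (hW.trans hV) t, map_zero, map_zero]⟩

lemma isZero_of_vanishesOn_top (h : M.VanishesOn ⊤) : Limits.IsZero M := by
  rw [Limits.IsZero.iff_id_eq_zero]
  refine hom_ext _ _ fun U ↦ AddCommGrpCat.ext fun s ↦ ?_
  exact (h U le_top _).trans (h U le_top _).symm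

lemma VanishesOn.of_affine (h : ∀ V : X.Opens, IsAffineOpen V → V ≤ O → ∀ s : Γ(M, V), s = 0) :
    M.VanishesOn O := by
  intro V hV s
  refine res_ext_of_mem fun x hx ↦ ?_
  obtain ⟨_, ⟨W, hW, rfl⟩, hxW, hWV⟩ := X.isBasis_affineOpens.exists_subset_of_mem_open hx V.isOpen
  exact ⟨W, hWV, hxW, (h W hW (le_trans hWV hV) _).trans (h W hW (le_trans hWV hV) _).symm⟩

/-- On a basic open `D(g) ⊆ V`, a section times a power of the unit `g` is the restriction of a
section over `U`. -/
lemma IsPowerExtendable.vanishesOn (hM : M.IsPowerExtendable) (hU : IsAffineOpen U) (hW : W ≤ U)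
    (h : ∀ s : Γ(M, U), M.res hW s = 0) : M.VanishesOn W := by
  intro V hV s
  refine res_ext_of_mem fun x hx ↦ ?_
  obtain ⟨g, hg, hxg⟩ := hU.exists_basicOpen_le ⟨x, hx⟩ (hW (hV hx))
  obtain ⟨n, t, ht⟩ := hM U hU g (M.res hg s)
  rw [← res_res hW (hg.trans hV), h, map_zero] at ht
  refine ⟨X.basicOpen g, hg, hxg, ?_⟩
  rw [map_zero]
  exact ((isUnit_resHom_basicOpen g).pow n).smul_left_cancel.mp (ht.symm.trans (smul_zero _).symm)

/-- A coherent module vanishes in a neighbourhood of a point at which its stalk is zero. -/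
lemma IsSectionwiseCoherent.exists_vanishesOn (hM : M.IsSectionwiseCoherent) {x : X}
    (hx : Limits.IsZero ((TopCat.Presheaf.stalkFunctor Ab x).obj M.presheaf)) :
    ∃ O : X.Opens, x ∈ O ∧ M.VanishesOn O := by
  obtain ⟨_, ⟨U, hU, rfl⟩, hxU, -⟩ := X.isBasis_affineOpens.exists_subset_of_mem_open
    (Set.mem_univ x) isOpen_univ
  obtain ⟨S, hS⟩ := (hM.finite U hU).fg_top
  have h (s : Γ(M, U)) : ∃ (W : X.Opens) (hW : W ≤ U), x ∈ W ∧ M.res hW s = 0 := by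
    have hs : M.presheaf.germ U x hxU s = M.presheaf.germ U x hxU 0 :=
      (AddCommGrpCat.subsingleton_of_isZero hx).elim _ _
    obtain ⟨W, hxW, i₁, i₂, h⟩ := M.presheaf.germ_eq x hxU hxU _ _ hs
    refine ⟨W, leOfHom i₁, hxW, ?_⟩
    exact h.trans (map_zero _)
  choose W hW hxW hs using h
  let O : X.Opens := U ⊓ S.inf W
  have hxO : x ∈ S.inf W := by
    rw [← SetLike.mem_coe, TopologicalSpace.Opens.coe_finset_inf]
    simpa using fun s _ ↦ hxW s
  refine ⟨O, ⟨hxU, hxO⟩, hM.extendable.vanishesOn hU inf_le_left fun s ↦ ?_⟩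
  have hs' : s ∈ Submodule.span Γ(X, U) (S : Set Γ(M, U)) := hS ▸ Submodule.mem_top
  induction hs' using Submodule.span_induction with
  | mem s hs₀ =>
    rw [← res_res (hW s) (inf_le_right.trans (Finset.inf_le hs₀)), hs, map_zero]
  | zero => rw [map_zero]
  | add s t _ _ h₁ h₂ => rw [map_add, h₁, h₂, add_zero]
  | smul a s _ h => rw [res_smul, h, smul_zero]

lemma IsPowerTorsion.exists_pow_smul_eq_zero_of_isCompact (hM : M.IsPowerTorsion)
    (hU : IsCompact (U : Set X)) (f : Γ(X, U)) (e : Γ(M, U)) (hWU : W ≤ U)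
    (hW : U ⊓ X.basicOpen f ≤ W) (he : M.res hWU e = 0) : ∃ n : ℕ, f ^ n • e = 0 := by
  refine exists_pow_smul_eq_zero_of_locally hU f e fun x hx ↦ ?_
  obtain ⟨_, ⟨V, hV, rfl⟩, hxV, hVU⟩ := X.isBasis_affineOpens.exists_subset_of_mem_open hx U.isOpen
  replace hVU : V ≤ U := hVU
  refine ⟨V, hVU, hxV, hM.exists_pow_smul_eq_zero hV hVU f _ (inf_le_left : V ⊓ W ≤ V)
    (le_inf inf_le_left ((inf_le_inf_right _ hVU).trans hW)) ?_⟩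
  rw [res_res, ← res_res hWU inf_le_right, he, map_zero]

/-- The sheaf `V ↦ Γ(M, U ⊓ V)`, i.e. the pushforward of the restriction of `M` to `U`. -/
noncomputable abbrev restrictPushforward (M : X.Modules) (U : X.Opens) : X.Modules :=
  (Modules.pushforward U.ι).obj (M.restrict U.ι)

/-- The sections of `restrictPushforward`. -/
noncomputable def sectionsRestrictPushforward (M : X.Modules) (U V : X.Opens) :
    Γ(M.restrictPushforward U, V) ≃+ Γ(M, U.ι ''ᵁ U.ι ⁻¹ᵁ V) := AddEquiv.refl _

lemma sectionsRestrictPushforward_smul (a : Γ(X, V)) (s : Γ(M.restrictPushforward U, V)) :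
    M.sectionsRestrictPushforward U V (a • s) =
      resHom (U.ι.image_preimage_le V) a • M.sectionsRestrictPushforward U V s :=
  congr($(U.ι.app_appIso_inv V) a • M.sectionsRestrictPushforward U V s)

lemma sectionsRestrictPushforward_res (h : V ≤ W) (s : Γ(M.restrictPushforward U, W)) :
    M.sectionsRestrictPushforward U V ((M.restrictPushforward U).res h s) =
      M.res (U.ι.image_mono (U.ι.preimage_mono h)) (M.sectionsRestrictPushforward U W s) := rfl

noncomputable def toRestrictPushforward (M : X.Modules) (U : X.Opens) :
    M ⟶ M.restrictPushforward U :=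
  (restrictAdjunction U.ι).unit.app M

/-- The intersection of `U` with an affine open need not be affine, but it is quasi-compact, so one
power of `f` works on all of it. -/
lemma IsPowerTorsion.restrictPushforward [TopologicalSpace.NoetherianSpace X]
    (hM : M.IsPowerTorsion) (U : X.Opens) : (M.restrictPushforward U).IsPowerTorsion := by
  intro V hV f t ht
  obtain ⟨n, hn⟩ := hM.exists_pow_smul_eq_zero_of_isCompact (TopologicalSpace.NoetherianSpace.isCompact _)
    (resHom (U.ι.image_preimage_le V) f) (M.sectionsRestrictPushforward U V t)
    (U.ι.image_mono (U.ι.preimage_mono (X.basicOpen_le f))) (by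
    rw [resHom, X.basicOpen_res, U.ι.image_preimage_eq_opensRange_inf,
      U.ι.image_preimage_eq_opensRange_inf]
    exact le_inf (inf_le_left.trans inf_le_left)
      (inf_le_right.trans inf_le_right)) (by rw [← sectionsRestrictPushforward_res (X.basicOpen_le f), ht, map_zero])
  refine ⟨n, (M.sectionsRestrictPushforward U V).injective ?_⟩
  rw [sectionsRestrictPushforward_smul, map_pow, hn, map_zero]

end AlgebraicGeometry.Scheme.Modules

/-! ### Associated points and the comparison with `i_* 𝒪_Z`. -/

namespace AlgebraicGeometry.Scheme.Modules

variable {X : Scheme.{u}} {M N F B : X.Modules} {U V W O : X.Opens}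

/-- A point of an affine open is an associated point of a nonzero module. -/
lemma exists_annihilator_eq_of_ne_zero (hU : IsAffineOpen U) [IsNoetherianRing Γ(X, U)]
    {s₀ : Γ(F, U)} (hs₀ : s₀ ≠ 0) :
    ∃ x ∈ U, ∃ s : Γ(F, U), ∀ f : Γ(X, U), f • s = 0 ↔ x ∉ X.basicOpen f := by
  obtain ⟨p, hp, -⟩ := exists_le_isAssociatedPrime_of_isNoetherianRing Γ(X, U) s₀ hs₀
  obtain ⟨hp, s, hs⟩ := isAssociatedPrime_iff.mp hp
  let y : Spec Γ(X, U) := ⟨p, hp⟩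
  have h := hU.opensRange_fromSpec.le ⟨y, rfl⟩
  refine ⟨hU.fromSpec y, h, s, fun f ↦ ?_⟩
  have h₁ : hU.fromSpec y ∈ X.basicOpen f ↔ f ∉ p := by
    have : hU.fromSpec y ∈ X.basicOpen f ↔ y ∈ hU.fromSpec ⁻¹ᵁ X.basicOpen f := Iff.rfl
    rw [this, hU.fromSpec_preimage_basicOpen]
    rfl
  rw [h₁, not_not, hs, Submodule.mem_colon_singleton, Submodule.mem_bot]

section

variable (hF : F.IsPowerTorsion) (hU : IsAffineOpen U) {s : Γ(F, U)} {x : X}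
  (hs : ∀ f : Γ(X, U), f • s = 0 ↔ x ∉ X.basicOpen f)

include hF hU hs

/-- Up to the unit `f ^ n`, `a` is the restriction of some `b` on `U`. Torsion turns `b • s = 0` on
`D(f)` into `f ^ k * b` annihilating `s` on `U`, where `hs` applies. -/
lemma smul_res_basicOpen_eq_zero_iff (f : Γ(X, U)) (a : Γ(X, X.basicOpen f)) :
    a • F.res (X.basicOpen_le f) s = 0 ↔ x ∉ X.basicOpen a := by
  obtain ⟨n, b, hb⟩ : ∃ (n : ℕ) (b : Γ(X, U)),
      resHom (X.basicOpen_le f) b = resHom (X.basicOpen_le f) f ^ n * a :=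
    (isSectionwiseCoherent_structureModule X).extendable U hU f a
  have hu := (isUnit_resHom_basicOpen f).pow n
  have h₁ : a • F.res (X.basicOpen_le f) s = 0 ↔ F.res (X.basicOpen_le f) (b • s) = 0 := by
    rw [res_smul, hb, mul_smul, hu.smul_eq_zero]
  have h₂ : X.basicOpen a = X.basicOpen f ⊓ X.basicOpen b := by
    have := X.basicOpen_res b (homOfLE (X.basicOpen_le f)).op
    change X.basicOpen (resHom (X.basicOpen_le f) b) = _ at this
    rw [← this, hb, X.basicOpen_mul, X.basicOpen_of_isUnit hu]
    exact (inf_eq_right.mpr (X.basicOpen_le a)).symm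
  rw [h₁, h₂]
  constructor
  · intro h hx
    obtain ⟨k, hk⟩ := hF U hU f _ h
    rw [← mul_smul, hs, X.basicOpen_mul] at hk
    refine hk ⟨?_, hx.2⟩
    obtain rfl | hk₀ := Nat.eq_zero_or_pos k
    · rw [pow_zero, X.basicOpen_of_isUnit isUnit_one]
      exact X.basicOpen_le f hx.1
    · rw [X.basicOpen_pow _ hk₀]
      exact hx.1
  · intro h
    rw [← X.basicOpen_mul, ← hs, mul_smul] at h
    refine (isUnit_resHom_basicOpen f).smul_eq_zero.mp ?_
    rw [← res_smul, h, map_zero]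

/-- Both sides can be tested on basic opens of `U` contained in `V`. In particular `s` vanishes on
every `V` that misses `x`. -/
lemma smul_res_eq_zero_iff (hV : V ≤ U) (a : Γ(X, V)) :
    a • F.res hV s = 0 ↔ x ∉ X.basicOpen a := by
  have key (f : Γ(X, U)) (hf : X.basicOpen f ≤ V) :
      F.res hf (a • F.res hV s) = 0 ↔ x ∉ X.basicOpen f ⊓ X.basicOpen a := by
    rw [res_smul, res_res, smul_res_basicOpen_eq_zero_iff hF hU hs, resHom, X.basicOpen_res]
  constructor
  · intro h hx
    obtain ⟨f, hf, hxf⟩ := hU.exists_basicOpen_le ⟨x, X.basicOpen_le a hx⟩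
      (hV (X.basicOpen_le a hx))
    exact (key f hf).mp (by rw [h, map_zero]) ⟨hxf, hx⟩
  · intro h
    refine res_ext_of_mem fun y hy ↦ ?_
    obtain ⟨f, hf, hyf⟩ := hU.exists_basicOpen_le ⟨y, hy⟩ (hV hy)
    exact ⟨X.basicOpen f, hf, hyf, by rw [map_zero, key]; exact fun h' ↦ h h'.2⟩

end

/-- The two maps have the same kernel, and `B` is the quotient of `M` by it. -/
lemma exists_mono_of_app_eq_zero_iff (e : M ⟶ B) [Epi e] (h : M ⟶ N)
    (H : ∀ (V : X.Opens) (a : Γ(M, V)), e.app V a = 0 ↔ h.app V a = 0) :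
    ∃ φ : B ⟶ N, Mono φ ∧ e ≫ φ = h := by
  have hk : Limits.kernel.ι e ≫ h = 0 := by
    refine hom_ext _ _ fun V ↦ AddCommGrpCat.ext fun a ↦ ?_
    rw [app_comp_apply]
    refine ((H V _).mp ?_).trans rfl
    rw [← app_comp_apply, Limits.kernel.condition]
    rfl
  refine ⟨Abelian.epiDesc e h hk, ?_, Abelian.comp_epiDesc e h hk⟩
  refine Preadditive.mono_of_cancel_zero _ fun {K} k hk' ↦ ?_
  refine hom_ext _ _ fun V ↦ AddCommGrpCat.ext fun s ↦ ?_
  refine res_ext_of_mem fun x hx ↦ ?_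
  obtain ⟨W, hW, t, hxW, ht⟩ := exists_local_preimage e (k.app V s) hx
  refine ⟨W, hW, hxW, ?_⟩
  rw [← ht, (H W t).mpr]
  · exact (map_zero _).symm
  · rw [← Abelian.comp_epiDesc e h hk, app_comp_apply, ht, app_res, ← app_comp_apply, hk']
    exact map_zero _

section

variable (u : F ⟶ N) (φ : B ⟶ N)

/-- The preimage of a subsheaf. -/
noncomputable abbrev preimage : X.Modules := Limits.kernel (u ≫ Limits.cokernel.π φ)

noncomputable def preimageι : preimage u φ ⟶ F := Limits.kernel.ι _

instance : Mono (preimageι u φ) := inferInstanceAs (Mono (Limits.kernel.ι _))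

noncomputable def preimageMap [Mono φ] : preimage u φ ⟶ B :=
  Abelian.monoLift φ (preimageι u φ ≫ u) (by
    rw [Category.assoc]; exact Limits.kernel.condition _)

lemma preimageMap_comp [Mono φ] : preimageMap u φ ≫ φ = preimageι u φ ≫ u :=
  Abelian.monoLift_comp _ _ _

lemma vanishesOn_kernel_preimageMap [Mono φ] (hu : ∀ V ≤ O, Function.Injective (u.app V)) :
    (Limits.kernel (preimageMap u φ)).VanishesOn O := by
  intro V hV s
  refine app_injective (Limits.kernel.ι _ ≫ preimageι u φ) V (hu V hV ?_)
  rw [← app_comp_apply, Category.assoc, ← preimageMap_comp, Limits.kernel.condition_assoc,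
    map_zero, map_zero]
  simp

lemma preimageMap_app_surjective [Mono φ] (hu : Function.Surjective (u.app V)) :
    Function.Surjective ((preimageMap u φ).app V) := by
  intro z
  obtain ⟨t, ht⟩ := hu (φ.app V z)
  obtain ⟨g, hg⟩ := exists_app_eq_of_exact (ShortComplex.exact_kernel (u ≫ Limits.cokernel.π φ)) t (by
    change (u ≫ Limits.cokernel.π φ).app V t = 0
    rw [app_comp_apply, ht, ← app_comp_apply, Limits.cokernel.condition]
    rfl)
  refine ⟨g, app_injective φ V ?_⟩
  rw [← app_comp_apply, preimageMap_comp, app_comp_apply, ← ht]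
  exact congrArg _ hg

lemma vanishesOn_cokernel_preimageMap [Mono φ] (hu : ∀ V ≤ O, Function.Surjective (u.app V)) :
    (Limits.cokernel (preimageMap u φ)).VanishesOn O := by
  intro V hV s
  refine res_ext_of_mem fun x hx ↦ ?_
  obtain ⟨W, hW, t, hxW, ht⟩ := exists_local_preimage (Limits.cokernel.π (preimageMap u φ)) s hx
  obtain ⟨g, rfl⟩ := preimageMap_app_surjective u φ (hu W (hW.trans hV)) t
  refine ⟨W, hW, hxW, ?_⟩
  rw [← ht, ← app_comp_apply, Limits.cokernel.condition, map_zero]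
  rfl

end

lemma res_bijective (h : V ≤ U) (h' : U ≤ V) : Function.Bijective (F.res h) := by
  obtain rfl := le_antisymm h h'
  have : ⇑(F.res h) = id := funext fun s ↦ res_self s
  rw [this]
  exact Function.bijective_id

lemma toRestrictPushforward_app_bijective (hV : V ≤ U) :
    Function.Bijective ((F.toRestrictPushforward U).app V) :=
  res_bijective (U.ι.image_preimage_le V) (by
    rw [U.ι.image_preimage_eq_opensRange_inf, U.opensRange_ι]
    exact le_inf hV le_rfl)

/-- A nonzero coherent module `F` has a nonzero coherent submodule which is generically
isomorphic to the structure sheaf of an integral closed subscheme. -/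
theorem exists_mono_of_not_isZero [AlgebraicGeometry.IsNoetherian X] (hF : F.IsSectionwiseCoherent)
    (hO : F.VanishesOn O) (hF₀ : ¬ Limits.IsZero F) :
    ∃ (Z : Scheme.{u}) (i : Z ⟶ X) (_ : IsClosedImmersion i) (_ : IsIntegral Z)
      (G : X.Modules) (ι : G ⟶ F) (ψ : G ⟶ (Modules.pushforward i).obj (structureModule Z))
      (U : X.Opens), Disjoint (Set.range i) O ∧ Mono ι ∧ G.IsSectionwiseCoherent ∧
      ¬ Limits.IsZero G ∧ O < U ∧ (Limits.kernel ψ).VanishesOn U ∧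
      (Limits.cokernel ψ).VanishesOn U := by
  obtain ⟨U, hU, s₀, hs₀⟩ : ∃ (U : X.Opens) (_ : IsAffineOpen U) (s : Γ(F, U)), s ≠ 0 := by
    by_contra! h
    exact hF₀ (isZero_of_vanishesOn_top (.of_affine fun V hV _ s ↦ h V hV s))
  have := IsLocallyNoetherian.component_noetherian ⟨U, hU⟩
  obtain ⟨x, hxU, s, hs⟩ := exists_annihilator_eq_of_ne_zero hU hs₀
  have hs' {V : X.Opens} (hV : V ≤ U) (a : Γ(X, V)) :=
    smul_res_eq_zero_iff hF.torsion hU hs hV a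
  have hxO : x ∉ O := fun hxO ↦ (hs' inf_le_left (1 : Γ(X, U ⊓ O))).mp
    (hO _ inf_le_right _) (by rw [X.basicOpen_of_isUnit isUnit_one]; exact ⟨hxU, hxO⟩)
  obtain ⟨Z, i, hi, hZ, hiZ⟩ := exists_isIntegral_range_eq_closure x
  have hdisj : Disjoint (Set.range i) O := by
    rw [hiZ]
    exact (Set.disjoint_singleton_left.mpr hxO).closure_left O.isOpen
  -- On the reduced scheme `Z` a function is zero when its nonvanishing locus is empty, and an open
  -- set misses the closure of `x` exactly when it misses `x`.
  have he (V : X.Opens) (a : Γ(X, V)) : (toPushforward i).app V a = 0 ↔ x ∉ X.basicOpen a := by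
    rw [toPushforward_app]
    refine (basicOpen_eq_bot_iff (X := Z) (i.app V a)).symm.trans ?_
    rw [← i.preimage_basicOpen, ← SetLike.coe_set_eq, TopologicalSpace.Opens.coe_bot]
    change i ⁻¹' X.basicOpen a = ∅ ↔ _
    rw [Set.preimage_eq_empty_iff, hiZ]
    exact ⟨fun h hx ↦ h.notMem_of_mem_left hx (subset_closure rfl),
      fun h ↦ (Set.disjoint_singleton_right.mpr h).closure_right (X.basicOpen a).isOpen⟩
  -- The section `s` exists only over `U`, but it is a global section of the pushforward of `F|_U`.
  let N := F.restrictPushforward U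
  let h : structureModule X ⟶ N := homOfSection (M := N)
    ((F.sectionsRestrictPushforward U ⊤).symm (F.res (by simp) s))
  have hh (V : X.Opens) (a : Γ(X, V)) : h.app V a = 0 ↔ x ∉ X.basicOpen a := by
    rw [homOfSection_app, ← (F.sectionsRestrictPushforward U V).map_eq_zero_iff,
      sectionsRestrictPushforward_smul, sectionsRestrictPushforward_res, AddEquiv.apply_symm_apply,
      res_res, hs', resHom, X.basicOpen_res, U.ι.image_preimage_eq_opensRange_inf, U.opensRange_ι]
    exact not_congr ⟨fun h ↦ h.2, fun h ↦ ⟨⟨hxU, X.basicOpen_le a h⟩, h⟩⟩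
  obtain ⟨φ, hφ, -⟩ := exists_mono_of_app_eq_zero_iff (toPushforward i) h
    fun V a ↦ (he V a).trans (hh V a).symm
  let u := F.toRestrictPushforward U
  have hB := isSectionwiseCoherent_pushforward_structureModule i
  have hBO : ((Modules.pushforward i).obj (structureModule Z)).VanishesOn O := by
    intro V hV z
    refine res_ext_of_mem fun y hy ↦ ?_
    obtain ⟨W, hW, t, hyW, ht⟩ := exists_local_preimage (toPushforward i) z hy
    refine ⟨W, hW, hyW, ?_⟩
    rw [← ht, map_zero]
    exact (he W t).mpr fun hx ↦ hxO (hV (hW (X.basicOpen_le t hx)))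
  have hN : N.IsPowerTorsion := hF.torsion.restrictPushforward U
  have hOU : O < O ⊔ U := left_lt_sup.mpr fun hUO ↦ hxO (hUO hxU)
  -- The preimage is the kernel of `F ⟶ cokernel φ`, so torsion of this cokernel makes it coherent.
  have hcok : (Limits.cokernel φ).IsPowerTorsion :=
    .of_shortExact_cokernel (shortExact_cokernel φ) hB.extendable hN
  refine ⟨Z, i, hi, hZ, preimage u φ, preimageι u φ, preimageMap u φ, O ⊔ U, hdisj, inferInstance,
    hF.kernel hcok _, fun h₀ ↦ ?_, hOU, ?_, ?_⟩
  -- Over `U` the map `u` is bijective, so the section `1` of `i_* 𝒪_Z` lifts to `G`; it is nonzero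
  -- because `x ∈ U`.
  · obtain ⟨g, hg⟩ := preimageMap_app_surjective u φ
      (toRestrictPushforward_app_bijective le_rfl).2 ((toPushforward i).app U (1 : Γ(X, U)))
    have hg' : (preimageMap u φ).app U g = 0 := by
      rw [h₀.eq_of_src (preimageMap u φ) 0]
      rfl
    rw [hg', eq_comm, he, X.basicOpen_of_isUnit isUnit_one] at hg
    exact hg hxU
  · exact .sup (.of_mono (Limits.kernel.ι _) (.of_mono (preimageι u φ) hO))
      (vanishesOn_kernel_preimageMap u φ fun V hV ↦ (toRestrictPushforward_app_bijective hV).1)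
  · exact .sup (.of_epi (Limits.cokernel.π _) hBO)
      (vanishesOn_cokernel_preimageMap u φ fun V hV ↦ (toRestrictPushforward_app_bijective hV).2)

end AlgebraicGeometry.Scheme.Modules

/-! ### Dévissage of coherent modules. -/

namespace AlgebraicGeometry.Scheme.Modules

variable {X : Scheme.{u}} {F G Q : X.Modules} {O : X.Opens}

lemma shortExact_kernel_factorThruImage (f : F ⟶ G) :
    (ShortComplex.mk (Limits.kernel.ι f) (Abelian.factorThruImage f) (by
      rw [← cancel_mono (Abelian.image.ι f)]; simp)).ShortExact where
  exact := by
    let S₁ : ShortComplex X.Modules := .mk (Limits.kernel.ι f) (Abelian.factorThruImage f) (by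
      rw [← cancel_mono (Abelian.image.ι f)]; simp)
    let S₂ : ShortComplex X.Modules := .mk (Limits.kernel.ι f) f (by simp)
    let φ : S₁ ⟶ S₂ := { τ₁ := 𝟙 _, τ₂ := 𝟙 _, τ₃ := Abelian.image.ι f }
    have : Epi φ.τ₁ := inferInstanceAs (Epi (𝟙 (Limits.kernel f)))
    have : IsIso φ.τ₂ := inferInstanceAs (IsIso (𝟙 F))
    have : Mono φ.τ₃ := inferInstanceAs (Mono (Abelian.image.ι f))
    exact (ShortComplex.exact_iff_of_epi_of_isIso_of_mono φ).mpr (ShortComplex.exact_kernel f)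

/-- The preimage of a submodule of a quotient is an extension. -/
lemma exists_shortExact_pullback (k : F ⟶ G) [Mono k] (ι : Q ⟶ Limits.cokernel k) [Mono ι] :
    ∃ (K : X.Modules) (a : F ⟶ K) (b : K ⟶ Q) (k' : K ⟶ G) (w : a ≫ b = 0),
      Mono k' ∧ a ≫ k' = k ∧ k' ≫ Limits.cokernel.π k = b ≫ ι ∧ (ShortComplex.mk a b w).ShortExact := by
  let a : F ⟶ Limits.pullback (Limits.cokernel.π k) ι := Limits.pullback.lift k 0 (by simp)
  have ha : a ≫ Limits.pullback.fst _ _ = k := Limits.pullback.lift_fst _ _ _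
  refine ⟨Limits.pullback (Limits.cokernel.π k) ι, a,
    Limits.pullback.snd _ _, Limits.pullback.fst _ _, Limits.pullback.lift_snd _ _ _, inferInstance, ha,
    Limits.pullback.condition, ?_⟩
  have : Mono a := mono_of_mono_fac ha
  refine { exact := ?_ }
  rw [ShortComplex.exact_iff_exact_up_to_refinements]
  intro A x hx
  have hx' : (x ≫ Limits.pullback.fst _ _) ≫ Limits.cokernel.π k = 0 := by
    rw [Category.assoc, Limits.pullback.condition, reassoc_of% hx, Limits.zero_comp]
  obtain ⟨A', π, hπ, y, hy⟩ := (ShortComplex.exact_cokernel k).exact_up_to_refinements _ hx'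
  refine ⟨A', π, hπ, y, Limits.pullback.hom_ext ?_ ?_⟩
  · dsimp
    rw [Category.assoc, Category.assoc, ha]
    exact hy
  · dsimp at hx ⊢
    rw [Category.assoc, Category.assoc, hx, Limits.pullback.lift_snd]
    simp

/-- `of_kernel` serves to pass from `i_* 𝒪_Z` to the image of a submodule in it; everything else is
built by extensions. -/
structure DevissageProperty (P : X.Modules → Prop) : Prop where
  of_isZero (M : X.Modules) (hM : Limits.IsZero M) : P M
  of_extension (S : ShortComplex X.Modules) (hS : S.ShortExact) (h₁ : S.X₁.IsSectionwiseCoherent)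
    (h₂ : S.X₂.IsSectionwiseCoherent) (h₃ : S.X₃.IsSectionwiseCoherent) (hP₁ : P S.X₁)
    (hP₃ : P S.X₃) : P S.X₂
  of_kernel (S : ShortComplex X.Modules) (hS : S.ShortExact) (h₁ : S.X₁.IsSectionwiseCoherent)
    (h₂ : S.X₂.IsSectionwiseCoherent) (h₃ : S.X₃.IsSectionwiseCoherent) (hP₂ : P S.X₂)
    (hP₃ : P S.X₃) : P S.X₁

variable {P : X.Modules → Prop} [AlgebraicGeometry.IsNoetherian X]

/-- Take a maximal coherent submodule `K` of `F` with `P K`. If `F / K` were nonzero, the preimage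
of a submodule `G` with `P G` would be an extension of `G` by `K`, hence a larger one. Maximality
makes sense because submodules are compared through their sections on a finite affine cover, where
the section modules of `F` are Noetherian. -/
lemma DevissageProperty.of_forall_exists_mono (hP : DevissageProperty P)
    (h : ∀ Q : X.Modules, Q.IsSectionwiseCoherent → Q.VanishesOn O → ¬ Limits.IsZero Q →
      ∃ (G : X.Modules) (ι : G ⟶ Q), Mono ι ∧ G.IsSectionwiseCoherent ∧ ¬ Limits.IsZero G ∧ P G)
    (hF : F.IsSectionwiseCoherent) (hO : F.VanishesOn O) : P F := by
  obtain ⟨c, hc⟩ := (isCompact_univ (X := X)).elim_finite_subcover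
    (fun U : X.affineOpens ↦ (U.1 : Set X)) (fun U ↦ U.1.isOpen) fun x _ ↦ by
      obtain ⟨_, ⟨W, hW, rfl⟩, hxW, -⟩ := X.isBasis_affineOpens.exists_subset_of_mem_open
        (Set.mem_univ x) isOpen_univ
      exact Set.mem_iUnion.mpr ⟨⟨W, hW⟩, hxW⟩
  have hnoeth (U : c) : WellFoundedGT (Submodule Γ(X, U.1.1) Γ(F, U.1.1)) := by
    have := IsLocallyNoetherian.component_noetherian U.1
    have := hF.finite U.1.1 U.1.2
    have := isNoetherian_of_isNoetherianRing_of_finite Γ(X, U.1.1) Γ(F, U.1.1)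
    infer_instance
  have hwf : WellFounded
      ((· > ·) : (∀ U : c, Submodule Γ(X, U.1.1) Γ(F, U.1.1)) → _ → Prop) :=
    (Pi.wellFoundedLT (α := fun U : c ↦ (Submodule Γ(X, U.1.1) Γ(F, U.1.1))ᵒᵈ)).wf
  let T : Set (∀ U : c, Submodule Γ(X, U.1.1) Γ(F, U.1.1)) :=
    {t | ∃ (K : X.Modules) (k : K ⟶ F), Mono k ∧ K.IsSectionwiseCoherent ∧ P K ∧
      t = fun U : c ↦ LinearMap.range (appₗ k U.1.1)}
  have hT : T.Nonempty := by
    refine ⟨_, Limits.kernel (𝟙 F), Limits.kernel.ι _, inferInstance, hF.kernel hF.torsion _,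
      hP.of_isZero _ (Limits.isZero_kernel_of_mono _), rfl⟩
  obtain ⟨_, ⟨K, k, hk, hK, hPK, rfl⟩, hmax⟩ := hwf.has_min T hT
  have hQ := hK.cokernel hF k
  have hS := shortExact_cokernel k
  by_cases hQ₀ : Limits.IsZero (Limits.cokernel k)
  · exact hP.of_extension _ hS hK hF hQ hPK (hP.of_isZero _ hQ₀)
  obtain ⟨G, ι, hι, hG, hG₀, hPG⟩ := h _ hQ (.of_epi (Limits.cokernel.π k) hO) hQ₀
  obtain ⟨K', a, b, k', w, hk', hak, hkb, hS'⟩ := exists_shortExact_pullback k ι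
  have hK' : K'.IsSectionwiseCoherent := .of_shortExact_extension hS' hK hG
  refine (hG₀ (isZero_of_vanishesOn_top ?_)).elim
  have hle : ∀ U : c, LinearMap.range (appₗ k U.1.1) ≤ LinearMap.range (appₗ k' U.1.1) := by
    rintro U _ ⟨t, rfl⟩
    exact ⟨a.app _ t, by rw [appₗ_apply, appₗ_apply, ← hak, app_comp_apply]⟩
  have heq : ∀ U : c, LinearMap.range (appₗ k' U.1.1) ≤ LinearMap.range (appₗ k U.1.1) := by
    by_contra hne
    exact hmax _ ⟨K', k', hk', hK', hP.of_extension _ hS' hK hK' hG hPK hPG, rfl⟩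
      (lt_of_le_not_ge hle hne)
  -- Sections of `G` over the affine `U` lift to `K'`, hence come from `K`, hence die in `F / K`.
  have hvan (U : c) : G.VanishesOn U.1.1 := by
    refine hG.extendable.vanishesOn U.1.2 le_rfl fun s ↦ ?_
    obtain ⟨t, rfl⟩ := surjective_app_of_shortExact hS' hK.extendable hK'.torsion hK'.extendable
      U.1.2 s
    obtain ⟨y, hy⟩ := heq U ⟨t, rfl⟩
    rw [appₗ_apply, appₗ_apply] at hy
    rw [res_self]
    refine app_injective ι _ ?_
    dsimp only
    rw [← app_comp_apply, ← hkb, app_comp_apply, ← hy, ← app_comp_apply, Limits.cokernel.condition,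
      map_zero]
    rfl
  refine .mono (.sSup (S := Set.range fun U : c ↦ U.1.1) ?_) fun x _ ↦ ?_
  · rintro _ ⟨U, rfl⟩
    exact hvan U
  · obtain ⟨U, hU, hxU⟩ := Set.mem_iUnion₂.mp (hc (Set.mem_univ x))
    exact TopologicalSpace.Opens.mem_sSup.mpr ⟨_, ⟨⟨U, hU⟩, rfl⟩, hxU⟩

/-- Dévissage: coherent modules are built from the structure sheaves of the integral closed
subschemes of their supports. -/
theorem DevissageProperty.of_isSectionwiseCoherent (hP : DevissageProperty P)
    (hZ : ∀ (Z : Scheme.{u}) (i : Z ⟶ X) (_ : IsClosedImmersion i) (_ : IsIntegral Z),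
      Disjoint (Set.range i) O → P ((Modules.pushforward i).obj (structureModule Z)))
    (hF : F.IsSectionwiseCoherent) (hO : F.VanishesOn O) : P F := by
  induction O using WellFoundedGT.induction generalizing F with
  | ind O ih =>
  refine hP.of_forall_exists_mono (O := O) (fun Q hQ hQO hQ₀ ↦ ?_) hF hO
  obtain ⟨Z, i, hi, hiZ, G, ι, ψ, U, hdisj, hι, hG, hG₀, hOU, hker, hcoker⟩ :=
    exists_mono_of_not_isZero hQ hQO hQ₀
  have hB := isSectionwiseCoherent_pushforward_structureModule i
  have ih' {M : X.Modules} (hM : M.IsSectionwiseCoherent) (hMU : M.VanishesOn U) : P M :=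
    ih U hOU (fun Z i h₁ h₂ h₃ ↦ hZ Z i h₁ h₂ (h₃.mono_right hOU.le)) hM hMU
  have hK := hG.kernel hB.torsion ψ
  have hI := hG.image hB.torsion ψ
  have hC := hG.cokernel hB ψ
  -- The image of `ψ` is the kernel of the map from `i_* 𝒪_Z` to the cokernel of `ψ`, to which the
  -- induction hypothesis applies.
  have hPI : P (Abelian.image ψ) := hP.of_kernel _ (shortExact_kernel (Limits.cokernel.π ψ)) hI hB
    hC (hZ Z i hi hiZ hdisj) (ih' hC hcoker)
  exact ⟨G, ι, hι, hG, hG₀, hP.of_extension _ (shortExact_kernel_factorThruImage ψ) hK hG hI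
    (ih' hK hker) hPI⟩

end AlgebraicGeometry.Scheme.Modules

/-! ### Triangulated subcategories, and reduction of a complex to its cohomology. -/

section Pretriangulated

variable {C : Type*} [Category* C] [Limits.HasZeroObject C] [HasShift C ℤ]
  [Preadditive C] [∀ n : ℤ, (shiftFunctor C n).Additive] [Pretriangulated C]

open Pretriangulated

/-- The objects of the ambient category which satisfy a property of a full subcategory. -/
def CategoryTheory.ObjectProperty.extend (P : ObjectProperty C)
    (Q : ObjectProperty P.FullSubcategory) : ObjectProperty C :=
  fun E ↦ ∃ h : P E, Q ⟨E, h⟩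

instance CategoryTheory.ObjectProperty.extend_isClosedUnderIsomorphisms (P : ObjectProperty C)
    [P.IsClosedUnderIsomorphisms] (Q : ObjectProperty P.FullSubcategory)
    [Q.IsClosedUnderIsomorphisms] : (P.extend Q).IsClosedUnderIsomorphisms where
  of_iso {E E'} e := fun ⟨h, hQ⟩ ↦
    ⟨P.prop_of_iso e h, Q.prop_of_iso (P.isoMk (X := ⟨E, h⟩) (Y := ⟨E', P.prop_of_iso e h⟩) e) hQ⟩

/-- Allows a subcategory of `D^b_coh(X)` to be studied inside `D(𝒪_X)`, where truncations are
available. A triangle whose outer terms satisfy `P` has its middle term in `P` and so lifts to the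
full subcategory. -/
instance CategoryTheory.ObjectProperty.extend_isTriangulated (P : ObjectProperty C)
    [P.IsClosedUnderIsomorphisms] [P.IsTriangulated] (Q : ObjectProperty P.FullSubcategory)
    [Q.IsClosedUnderIsomorphisms] [Q.IsTriangulated] : (P.extend Q).IsTriangulated where
  exists_zero := by
    obtain ⟨Z, hZ, hQZ⟩ := Q.exists_prop_of_containsZero
    exact ⟨Z.obj, P.ι.map_isZero hZ, Z.property, hQZ⟩
  isStableUnderShiftBy n :=
    { le_shift := by
        rintro E ⟨h, hQ⟩
        have h' := P.le_shift n _ h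
        exact ⟨h', Q.prop_of_iso (P.isoMk (Y := ⟨_, h'⟩) ((P.ι.commShiftIso n).app ⟨E, h⟩))
          (Q.le_shift n _ hQ)⟩ }
  toIsTriangulatedClosed₂ := .mk' fun T hT ⟨h₁, hQ₁⟩ ⟨h₃, hQ₃⟩ ↦ by
    have h₂ := P.ext_of_isTriangulatedClosed₂ T hT h₁ h₃
    let T' : Triangle P.FullSubcategory := .mk (X := ⟨_, h₁⟩) (Y := ⟨_, h₂⟩) (Z := ⟨_, h₃⟩)
      (ObjectProperty.homMk T.mor₁) (ObjectProperty.homMk T.mor₂)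
      (ObjectProperty.homMk (T.mor₃ ≫ (P.ι.commShiftIso (1 : ℤ)).inv.app ⟨_, h₁⟩))
    have hT' : T' ∈ distTriang P.FullSubcategory := by
      refine isomorphic_distinguished _ hT _ ?_
      have h : (T.mor₃ ≫ (P.ι.commShiftIso (1 : ℤ)).inv.app ⟨_, h₁⟩) ≫
          (P.ι.commShiftIso (1 : ℤ)).hom.app ⟨_, h₁⟩ = T.mor₃ := by
        rw [Category.assoc, Iso.inv_hom_id_app]
        exact Category.comp_id _
      exact Triangle.isoMk _ _ (Iso.refl _) (Iso.refl _) (Iso.refl _)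
        ((Category.comp_id _).trans (Category.id_comp _).symm)
        ((Category.comp_id _).trans (Category.id_comp _).symm)
        (congr(_ ≫ $(Functor.map_id _ _)).trans ((Category.comp_id _).trans
          (h.trans (Category.id_comp _).symm)))
    exact ⟨h₂, Q.ext_of_isTriangulatedClosed₂ T' hT' hQ₁ hQ₃⟩

end Pretriangulated

namespace DerivedCategory

variable {A : Type*} [Category* A] [Abelian A] [HasDerivedCategory.{w} A]

noncomputable def homologySingleFunctorIso (n : ℤ) (M : A) :
    (homologyFunctor A n).obj ((singleFunctor A n).obj M) ≅ M :=
  (homologyFunctor A n).mapIso ((singleFunctorIsoCompQ A n).app M) ≪≫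
    (homologyFunctorFactors A n).app _ ≪≫
      HomologicalComplex.singleObjHomologySelfIso (ComplexShape.up ℤ) n M

open Pretriangulated

/-- An object with cohomology in a single degree is a shift of its cohomology. -/
lemma prop_of_prop_single_homology_of_isGE_of_isLE (R : ObjectProperty (DerivedCategory A))
    [R.IsTriangulated] [R.IsClosedUnderIsomorphisms] (E : DerivedCategory A) (a : ℤ)
    [E.IsGE a] [E.IsLE a] (h : R ((singleFunctor A 0).obj ((homologyFunctor A a).obj E))) :
    R E := by
  obtain ⟨M, ⟨e⟩⟩ := exists_iso_singleFunctor_obj_of_isGE_of_isLE E a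
  let e' := (homologyFunctor A a).mapIso e ≪≫ homologySingleFunctorIso a M
  have h₁ : R ((singleFunctor A 0).obj M) := R.prop_of_iso ((singleFunctor A 0).mapIso e') h
  refine R.prop_of_iso e.symm ?_
  exact R.prop_of_iso (((singleFunctors A).shiftIso (-a) a 0 (by simp)).app M)
    (R.le_shift (-a) _ h₁)

/-- A bounded object of the derived category lies in every triangulated subcategory containing its
cohomology objects. -/
lemma prop_of_prop_single_homology (R : ObjectProperty (DerivedCategory A)) [R.IsTriangulated]
    [R.IsClosedUnderIsomorphisms] (E : DerivedCategory A) (a b : ℤ) [hE : E.IsGE a] [hE' : E.IsLE b]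
    (h : ∀ n, R ((singleFunctor A 0).obj ((homologyFunctor A n).obj E))) : R E := by
  obtain hab | hab := lt_or_ge b a
  · exact R.prop_of_isZero (TStructure.t.isZero E b a hab)
  obtain ⟨k, rfl⟩ := Int.le.dest hab
  clear hab
  induction k generalizing E with
  | zero =>
    have : E.IsLE a := by simpa using hE'
    exact prop_of_prop_single_homology_of_isGE_of_isLE R E a (h a)
  | succ k ih =>
    -- Splits off the top cohomology: `X` has the cohomology of `E` in degrees up to `a + k`, and
    -- `Y` is concentrated in degree `a + k + 1`.
    obtain ⟨X, Y, hX, hY, f, g, δ, hT⟩ := TStructure.t.exists_triangle E (a + k) (a + k + 1) rfl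
    have hX : X.IsLE (a + k) := ⟨hX⟩
    have hY : Y.IsGE (a + k + 1) := ⟨hY⟩
    have hXi (n : ℤ) (hn : n ≤ a + k) : IsIso ((homologyFunctor A n).map f) := by
      have h₁ : Mono ((homologyFunctor A n).map f) :=
        (HomologySequence.mono_homologyMap_mor₁_iff _ hT (n - 1) n (by lia)).mpr
          ((isZero_of_isGE Y (a + k + 1) (n - 1) (by lia)).eq_of_src _ _)
      have h₂ : Epi ((homologyFunctor A n).map f) :=
        (HomologySequence.epi_homologyMap_mor₁_iff _ hT n).mpr
          ((isZero_of_isGE Y (a + k + 1) n (by lia)).eq_of_tgt _ _)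
      exact isIso_of_mono_of_epi _
    have hYi (n : ℤ) (hn : a + k + 1 ≤ n) : IsIso ((homologyFunctor A n).map g) := by
      have h₁ : Mono ((homologyFunctor A n).map g) :=
        (HomologySequence.mono_homologyMap_mor₂_iff _ hT n).mpr
          ((isZero_of_isLE X (a + k) n (by lia)).eq_of_src _ _)
      have h₂ : Epi ((homologyFunctor A n).map g) :=
        (HomologySequence.epi_homologyMap_mor₂_iff _ hT n (n + 1) rfl).mpr
          ((isZero_of_isLE X (a + k) (n + 1) (by lia)).eq_of_tgt _ _)
      exact isIso_of_mono_of_epi _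
    have hX' : X.IsGE a := by
      rw [isGE_iff]
      intro n hn
      have := hXi n (by lia)
      exact (isZero_of_isGE E a n hn).of_iso (asIso ((homologyFunctor A n).map f))
    have hY' : Y.IsLE (a + k + 1) := by
      rw [isLE_iff]
      intro n hn
      have := hYi n (by lia)
      exact (isZero_of_isLE E (a + (k + 1 : ℕ)) n (by push_cast; lia)).of_iso
        (asIso ((homologyFunctor A n).map g)).symm
    refine R.ext_of_isTriangulatedClosed₂ _ hT (ih X fun n ↦ ?_) ?_
    · obtain hn | hn := le_or_gt n (a + k)
      · have := hXi n hn
        exact R.prop_of_iso ((singleFunctor A 0).mapIso (asIso ((homologyFunctor A n).map f))).symm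
          (h n)
      · exact R.prop_of_isZero ((singleFunctor A 0).map_isZero (isZero_of_isLE X _ n hn))
    · have := hYi _ le_rfl
      exact prop_of_prop_single_homology_of_isGE_of_isLE R Y _ (R.prop_of_iso ((singleFunctor A 0).mapIso
        (asIso ((homologyFunctor A (a + k + 1)).map g))) (h _))

end DerivedCategory

/-- Applied to the long exact cohomology sequence of a triangle, this presents the cohomology of the
middle vertex as an extension of a kernel by a cokernel of maps between the outer ones. -/
lemma CategoryTheory.ShortComplex.exists_shortExact_of_exact {A : Type*} [Category* A] [Abelian A]
    {M₁ M₂ M₃ M₄ M₅ : A} {f₁ : M₁ ⟶ M₂} {f₂ : M₂ ⟶ M₃} {f₃ : M₃ ⟶ M₄} {f₄ : M₄ ⟶ M₅}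
    (w₁ : f₁ ≫ f₂ = 0) (w₂ : f₂ ≫ f₃ = 0) (w₃ : f₃ ≫ f₄ = 0) (h₁ : (ShortComplex.mk f₁ f₂ w₁).Exact)
    (h₂ : (ShortComplex.mk f₂ f₃ w₂).Exact) (h₃ : (ShortComplex.mk f₃ f₄ w₃).Exact) :
    ∃ (i : Limits.cokernel f₁ ⟶ M₃) (p : M₃ ⟶ Limits.kernel f₄) (w : i ≫ p = 0),
      (ShortComplex.mk i p w).ShortExact := by
  let i : Limits.cokernel f₁ ⟶ M₃ := Limits.cokernel.desc f₁ f₂ w₁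
  let p : M₃ ⟶ Limits.kernel f₄ := Limits.kernel.lift f₄ f₃ w₃
  have hi : Mono i := h₁.mono_cokernelDesc
  have hp : Epi p := h₃.epi_kernelLift
  have hw : f₂ ≫ p = 0 := by
    rw [← cancel_mono (Limits.kernel.ι f₄)]
    simp [p, w₂]
  have w : i ≫ p = 0 := by
    rw [← cancel_epi (Limits.cokernel.π f₁)]
    simp [i, hw]
  refine ⟨i, p, w, { exact := ?_ }⟩
  let φ : ShortComplex.mk f₂ p hw ⟶ ShortComplex.mk f₂ f₃ w₂ :=
    { τ₁ := 𝟙 _, τ₂ := 𝟙 _, τ₃ := Limits.kernel.ι f₄, comm₂₃ := by simp [p] }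
  let ψ : ShortComplex.mk f₂ p hw ⟶ ShortComplex.mk i p w :=
    { τ₁ := Limits.cokernel.π f₁, τ₂ := 𝟙 _, τ₃ := 𝟙 _, comm₁₂ := by simp [i] }
  have : Epi φ.τ₁ := inferInstanceAs (Epi (𝟙 M₂))
  have : IsIso φ.τ₂ := inferInstanceAs (IsIso (𝟙 M₃))
  have : Mono φ.τ₃ := inferInstanceAs (Mono (Limits.kernel.ι f₄))
  have : Epi ψ.τ₁ := inferInstanceAs (Epi (Limits.cokernel.π f₁))
  have : IsIso ψ.τ₂ := inferInstanceAs (IsIso (𝟙 M₃))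
  have : Mono ψ.τ₃ := inferInstanceAs (Mono (𝟙 (Limits.kernel f₄)))
  exact (ShortComplex.exact_iff_of_epi_of_isIso_of_mono ψ).mp
    ((ShortComplex.exact_iff_of_epi_of_isIso_of_mono φ).mpr h₂)

/-! ### The category `D^b_coh(X)` and the generation theorem. -/

namespace AlgebraicGeometry.Scheme

open Pretriangulated

section

variable {X : Scheme.{u}} [HasDerivedCategory.{w} X.Modules]

lemma isBoundedCoherent_iff (E : DerivedCategory X.Modules) : isBoundedCoherent X E ↔
    (∃ a b : ℤ, ∀ n : ℤ, (n < a ∨ b < n) →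
      Limits.IsZero ((DerivedCategory.homologyFunctor X.Modules n).obj E)) ∧
    ∀ n : ℤ, ((DerivedCategory.homologyFunctor X.Modules n).obj E).IsSectionwiseCoherent :=
  and_congr_right fun _ ↦ forall_congr' fun _ ↦ isCoherentModule_iff

lemma devissageProperty_single (R : ObjectProperty (DerivedCategory X.Modules)) [R.IsTriangulated]
    [R.IsClosedUnderIsomorphisms] :
    Modules.DevissageProperty
      fun M : X.Modules ↦ R ((DerivedCategory.singleFunctor X.Modules 0).obj M) where
  of_isZero _ hM := R.prop_of_isZero (Functor.map_isZero _ hM)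
  of_extension _ hS _ _ _ h₁ h₃ :=
    R.ext_of_isTriangulatedClosed₂ _ hS.singleTriangle_distinguished h₁ h₃
  of_kernel _ hS _ _ _ h₂ h₃ :=
    R.ext_of_isTriangulatedClosed₁ _ hS.singleTriangle_distinguished h₂ h₃

variable [IsLocallyNoetherian X]

instance isBoundedCoherent_isClosedUnderIsomorphisms :
    (isBoundedCoherent X).IsClosedUnderIsomorphisms where
  of_iso {E E'} e h := by
    rw [isBoundedCoherent_iff] at h ⊢
    obtain ⟨⟨a, b, h₁⟩, h₂⟩ := h
    exact ⟨⟨a, b, fun n hn ↦ (h₁ n hn).of_iso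
      ((DerivedCategory.homologyFunctor X.Modules n).mapIso e.symm)⟩,
      fun n ↦ (h₂ n).of_iso ((DerivedCategory.homologyFunctor X.Modules n).mapIso e)⟩

instance isBoundedCoherent_isTriangulated : (isBoundedCoherent X).IsTriangulated where
  exists_zero := by
    obtain ⟨Z, hZ⟩ := Limits.HasZeroObject.zero (C := DerivedCategory X.Modules)
    exact ⟨Z, hZ, (isBoundedCoherent_iff _).mpr ⟨⟨0, 0, fun n _ ↦ Functor.map_isZero _ hZ⟩,
      fun n ↦ .of_isZero (Functor.map_isZero _ hZ)⟩⟩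
  isStableUnderShiftBy m :=
    { le_shift := by
        intro E h
        change isBoundedCoherent X _
        rw [isBoundedCoherent_iff] at h ⊢
        obtain ⟨⟨a, b, h₁⟩, h₂⟩ := h
        have e (n : ℤ) : (DerivedCategory.homologyFunctor X.Modules n).obj (E⟦m⟧) ≅
            (DerivedCategory.homologyFunctor X.Modules (m + n)).obj E :=
          ((DerivedCategory.homologyFunctor X.Modules 0).shiftIso m n (m + n) rfl).app E
        exact ⟨⟨a - m, b - m, fun n hn ↦ (h₁ (m + n) (by lia)).of_iso (e n)⟩,
          fun n ↦ (h₂ (m + n)).of_iso (e n).symm⟩ }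
  toIsTriangulatedClosed₂ := .mk' fun T hT h₁ h₃ ↦ by
    rw [isBoundedCoherent_iff] at h₁ h₃ ⊢
    obtain ⟨⟨a, b, h₁⟩, h₁'⟩ := h₁
    obtain ⟨⟨a', b', h₃⟩, h₃'⟩ := h₃
    refine ⟨⟨min a a', max b b', fun n hn ↦ ?_⟩, fun n ↦ ?_⟩
    · exact (DerivedCategory.HomologySequence.exact₂ T hT n).isZero_of_both_zeros
        ((h₁ n (by lia)).eq_of_src _ _) ((h₃ n (by lia)).eq_of_tgt _ _)
    · obtain ⟨i, p, w, hS⟩ := ShortComplex.exists_shortExact_of_exact _ _ _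
        (DerivedCategory.HomologySequence.exact₁ T hT (n - 1) n (by lia))
        (DerivedCategory.HomologySequence.exact₂ T hT n)
        (DerivedCategory.HomologySequence.exact₃ T hT n (n + 1) rfl)
      exact .of_shortExact_extension hS ((h₃' _).cokernel (h₁' _) _)
        ((h₃' _).kernel (h₁' _).torsion _)

lemma isBoundedCoherent_single {M : X.Modules} (hM : M.IsSectionwiseCoherent) :
    isBoundedCoherent X ((DerivedCategory.singleFunctor X.Modules 0).obj M) := by
  have h (n : ℤ) (hn : n < 0 ∨ 0 < n) : Limits.IsZero ((DerivedCategory.homologyFunctor X.Modules n).obj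
      ((DerivedCategory.singleFunctor X.Modules 0).obj M)) := by
    obtain hn | hn := hn
    · exact DerivedCategory.isZero_of_isGE _ 0 n hn
    · exact DerivedCategory.isZero_of_isLE _ 0 n hn
  refine (isBoundedCoherent_iff _).mpr ⟨⟨0, 0, h⟩, fun n ↦ ?_⟩
  obtain rfl | hn := eq_or_ne n 0
  · exact hM.of_iso (DerivedCategory.homologySingleFunctorIso 0 M).symm
  · exact .of_isZero (h n (by lia))

variable (X) in
lemma integralStructureSheaves_le : integralStructureSheaves X ≤ isBoundedCoherent X := by
  rintro E ⟨Z, i, hi, -, ⟨e⟩⟩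
  exact (isBoundedCoherent X).prop_of_iso e.symm
    (isBoundedCoherent_single (Modules.isSectionwiseCoherent_pushforward_structureModule i))

end

variable {X : Scheme.{u}} [AlgebraicGeometry.IsNoetherian X] [HasDerivedCategory.{w} X.Modules]

/-- A bounded complex with coherent cohomology lies in every triangulated subcategory containing
the structure sheaves of the integral closed subschemes of its support. -/
theorem prop_of_forall_pushforwardStructureSheaf (R : ObjectProperty (DerivedCategory X.Modules))
    [R.IsTriangulated] [R.IsClosedUnderIsomorphisms] {E : DerivedCategory X.Modules}
    (hE : isBoundedCoherent X E)
    (hR : ∀ (Z : Scheme.{u}) (i : Z ⟶ X) (_ : IsClosedImmersion i) (_ : IsIntegral Z),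
      Set.range i ⊆ derivedSupport E → R (pushforwardStructureSheaf i)) : R E := by
  obtain ⟨⟨a, b, h₁⟩, h₂⟩ := (isBoundedCoherent_iff E).mp hE
  have hE₁ : E.IsGE a := (DerivedCategory.isGE_iff _ _).mpr fun n hn ↦ h₁ n (.inl hn)
  have hE₂ : E.IsLE b := (DerivedCategory.isLE_iff _ _).mpr fun n hn ↦ h₁ n (.inr hn)
  refine DerivedCategory.prop_of_prop_single_homology R E a b fun n ↦ ?_
  let F := (DerivedCategory.homologyFunctor X.Modules n).obj E
  -- `O` is the largest open set on which `F` vanishes. A point outside `O` has nonzero stalk by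
  -- `exists_vanishesOn`, so a `Z` disjoint from `O` lies in the support of `E`.
  refine (devissageProperty_single R).of_isSectionwiseCoherent
    (O := sSup {O | F.VanishesOn O}) (fun Z i hi hZ hdisj ↦ hR Z i hi hZ ?_) (h₂ n)
    (.sSup fun O hO ↦ hO)
  rintro _ ⟨z, rfl⟩
  refine ⟨n, fun h₀ ↦ ?_⟩
  obtain ⟨O, hzO, hO⟩ := (h₂ n).exists_vanishesOn h₀
  exact hdisj.notMem_of_mem_left ⟨z, rfl⟩ (TopologicalSpace.Opens.mem_sSup.mpr ⟨O, hO, hzO⟩)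

lemma thickClosure_of_forall_pushforwardStructureSheaf (P : ObjectProperty (DerivedCategory X.Modules))
    (E : DbCoh X)
    (hP : ∀ (Z : Scheme.{u}) (i : Z ⟶ X) (_ : IsClosedImmersion i) (_ : IsIntegral Z),
      Set.range i ⊆ derivedSupport E.obj → P (pushforwardStructureSheaf i)) :
    (P.inverseImage (isBoundedCoherent X).ι).thickClosure E := by
  intro Q _ _ hPQ
  obtain ⟨_, h⟩ := prop_of_forall_pushforwardStructureSheaf ((isBoundedCoherent X).extend Q)
    E.property fun Z i hi hZ hZE ↦
      ⟨isBoundedCoherent_single (Modules.isSectionwiseCoherent_pushforward_structureModule i),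
        hPQ _ (hP Z i hi hZ hZE)⟩
  exact h

end AlgebraicGeometry.Scheme

theorem proposition4p3 (X : Scheme.{u})
    [AlgebraicGeometry.IsNoetherian X] [HasDerivedCategory.{w} X.Modules] :
    -- `D^b_coh(X)` is a triangulated subcategory of `D(𝒪_X)` and contains the sheaves `i_* 𝒪_Z`;
    -- below it carries the induced triangulated structure
    ∃ _ : (Scheme.isBoundedCoherent X).IsTriangulated,
      Scheme.integralStructureSheaves X ≤ Scheme.isBoundedCoherent X ∧
      (∀ (l : ℕ) (E : Scheme.DbCoh X),
        topologicalKrullDim (Scheme.derivedSupport E.obj) ≤ l →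
          ((Scheme.integralStructureSheavesOfDimLE X l).inverseImage
            (Scheme.isBoundedCoherent X).ι).thickClosure E) ∧
      (topologicalKrullDim X < ⊤ →
        ((Scheme.integralStructureSheaves X).inverseImage
          (Scheme.isBoundedCoherent X).ι).thickClosure = ⊤) := by
  refine ⟨inferInstance, Scheme.integralStructureSheaves_le X, fun l E hE ↦ ?_, fun _ ↦ ?_⟩
  · refine Scheme.thickClosure_of_forall_pushforwardStructureSheaf _ E fun Z i hi hZ hZE ↦
      ⟨Z, i, hi, hZ, le_trans ?_ hE, ⟨Iso.refl _⟩⟩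
    -- `Z` carries the topology induced from `supp E`, so its dimension is no larger.
    exact (i.isClosedEmbedding.isInducing.codRestrict fun z ↦ hZE ⟨z, rfl⟩).topologicalKrullDim_le
  · refine funext fun E ↦ eq_true ?_
    exact Scheme.thickClosure_of_forall_pushforwardStructureSheaf _ E fun Z i hi hZ _ ↦
      ⟨Z, i, hi, hZ, ⟨Iso.refl _⟩⟩
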